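/- Let $n_1,n_2\ge 0$ be integers and $n=n_1+n_2+1$. All manifolds and maps are smooth and manifolds have no boundary. $\mathbb{S}^{2m+1}$ is the unit sphere of $\mathbb{C}^{m+1}$ with its Euclidean metric $\langle\,,\rangle$ and complex structure $J$ (multiplication by $i$), and $\mathbb{CP}^m$ carries the Fubini–Study metric of constant holomorphic sectional curvature $4$, its complex structure $J$ and the Kähler form $\omega=\langle J\cdot,\cdot\rangle$; $[z]\in\mathbb{CP}^m$ denotes the class of $z\in\mathbb{S}^{2m+1}$. An immersion $\phi:M^m\to\mathbb{S}^{2m+1}$ of an $m$-dimensional manifold is Legendrian if $\langle \phi_*v,J\phi\rangle=0$ for all tangent vectors $v$ of $M$; an immersion $\Phi:M^m\to\mathbb{CP}^m$ of an $m$-dimensional manifold is Lagrangian if $\Phi^*\omega=0$. In both cases $M$ carries the induced metric, $H$ is the mean curvature vector ($1/m$ times the trace of the second fundamental form in the sphere, respectively in $\mathbb{CP}^m$; $H=0$ if $m=0$), $JH$ is tangent to $M$, and the immersion is minimal if $H=0$. A Legendrian immersion is C-minimal, and a Lagrangian immersion is H-minimal, if $\operatorname{div}JH=0$ on $M$. Let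 $N_i$ be a non-empty $n_i$-dimensional manifold and $\psi_i:N_i\to\mathbb{S}^{2n_i+1}$ a C-minimal Legendrian immersion, $i=1,2$, and let $\delta\in(0,\pi/2)$. Then $$\Phi_\delta(e^{is},p,q)=\bigl[\bigl(\cos\delta\,e^{is\sin^2\delta}\,\psi_1(p),\ \sin\delta\,e^{-is\cos^2\delta}\,\psi_2(q)\bigr)\bigr],\qquad s\in\mathbb{R},\ p\in N_1,\ q\in N_2,$$ is a well-defined map $\Phi_\delta:\mathbb{S}^1\times N_1\times N_2\to\mathbb{CP}^n$, and it is an H-minimal Lagrangian immersion. Moreover, $\Phi_\delta$ is minimal if and only if both $\psi_1$ and $\psi_2$ are minimal and $\tan^2\delta=(n_2+1)/(n_1+1)$. -/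

import Mathlib

open Module Set Topology
open scoped Manifold ContDiff LinearAlgebra.Projectivization

noncomputable section

namespace LagrangianCP

/-! ### Linear algebra of a scalar product `g` on a finite-dimensional real vector space -/

section LinearAlgebra

variable {E F : Type*} [NormedAddCommGroup E] [NormedSpace ℝ E] [FiniteDimensional ℝ E]
  [NormedAddCommGroup F] [NormedSpace ℝ F]

/-- The Gram matrix `g_ij = g(b_i, b_j)` of `g` in a fixed basis `b` of `E`. -/
def gram (g : E → E → ℝ) : Matrix (Fin (finrank ℝ E)) (Fin (finrank ℝ E)) ℝ :=
  Matrix.of fun i j => g (finBasis ℝ E i) (finBasis ℝ E j)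

/-- The vector `α^♯ = g^{ij} α(b_j) b_i` with `g(α^♯, v) = α(v)`, for a linear form `α`
and a scalar product `g`. -/
def sharp (g : E → E → ℝ) (α : E → ℝ) : E :=
  ∑ i, ∑ j, ((gram g)⁻¹ i j * α (finBasis ℝ E j)) • finBasis ℝ E i

/-- The trace `g^{ij} B(b_i, b_j)` of a bilinear map `B` with respect to `g`. -/
def metricTrace (g : E → E → ℝ) (B : E → E → F) : F :=
  ∑ i, ∑ j, (gram g)⁻¹ i j • B (finBasis ℝ E i) (finBasis ℝ E j)

/-- For an injective linear map `A : E → F` and a scalar product `h` on `F`: the vector `X` of `E`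
for which `A X` is the `h`-orthogonal projection of `ξ` to the image of `A`. -/
def tangentPart (h : F → F → ℝ) (A : E →L[ℝ] F) (ξ : F) : E :=
  sharp (fun u v => h (A u) (A v)) (fun v => h ξ (A v))

/-- The component of `ξ` that is `h`-orthogonal to the image of `A`. -/
def normalPart (h : F → F → ℝ) (A : E →L[ℝ] F) (ξ : F) : F :=
  ξ - A (tangentPart h A ξ)

end LinearAlgebra

/-! ### Riemannian geometry of a map, in local coordinates

A Riemannian metric in coordinates is a map `h : F → F → F → ℝ`: `h y u v` is the scalar product at
the point `y` of the vectors `u`, `v`. -/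

section Coordinates

variable {E F : Type*} [NormedAddCommGroup E] [NormedSpace ℝ E] [FiniteDimensional ℝ E]
  [NormedAddCommGroup F] [NormedSpace ℝ F] [FiniteDimensional ℝ F]

/-- The Christoffel map `Γ_y(u, v)` of the Levi-Civita connection of `h`:
`2 h(Γ(u, v), w) = ∂_u h(v, w) + ∂_v h(u, w) - ∂_w h(u, v)`. -/
def christoffel (h : F → F → F → ℝ) (y u v : F) : F :=
  sharp (h y) fun w =>
    (fderiv ℝ (fun z => h z v w) y u + fderiv ℝ (fun z => h z u w) y v
      - fderiv ℝ (fun z => h z u v) y w) / 2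

/-- The metric induced by the map `f`. -/
def inducedMetric (h : F → F → F → ℝ) (f : E → F) (x u v : E) : ℝ :=
  h (f x) (fderiv ℝ f x u) (fderiv ℝ f x v)

/-- The second fundamental form `σ(u, v)` of the immersion `f`: the normal component of the
Levi-Civita derivative in the direction `f_* u` of `f_* v`. -/
def secondFundamentalForm (h : F → F → F → ℝ) (f : E → F) (x u v : E) : F :=
  normalPart (h (f x)) (fderiv ℝ f x)
    (fderiv ℝ (fun z => fderiv ℝ f z v) x u
      + christoffel h (f x) (fderiv ℝ f x u) (fderiv ℝ f x v))

/-- The mean curvature vector `H = (1/n) trace σ`, `n = dim E`, of the immersion `f`. -/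
def meanCurvature (h : F → F → F → ℝ) (f : E → F) (x : E) : F :=
  (finrank ℝ E : ℝ)⁻¹ • metricTrace (inducedMetric h f x) (secondFundamentalForm h f x)

/-- The divergence `(1/√G) ∂_i (√G X^i)`, `G = det (g_ij)`, of a vector field `X` with respect to
the Riemannian metric `g`. -/
def divergence (g : E → E → E → ℝ) (X : E → E) (x : E) : ℝ :=
  (√(gram (g x)).det)⁻¹ *
    ∑ i, fderiv ℝ (fun z => √(gram (g z)).det * (finBasis ℝ E).coord i (X z)) x (finBasis ℝ E i)

end Coordinates

/-! ### Complex projective space -/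

/-- The complex Euclidean space `ℂ^n`. -/
abbrev CSpace (n : ℕ) : Type := EuclideanSpace ℂ (Fin n)

/-- The unit sphere `S^{2n+1}` of `ℂ^{n+1}`. -/
abbrev USphere (n : ℕ) : Type := Metric.sphere (0 : CSpace (n + 1)) 1

/-- The complex projective space `ℂP^n`. -/
def CP (n : ℕ) : Type := ℙ ℂ (CSpace (n + 1))

namespace CP

variable {n : ℕ}

/-- The class `[v]` of a non-zero vector. -/
def mk (v : {v : CSpace (n + 1) // v ≠ 0}) : CP n := Projectivization.mk' ℂ v

/-- The quotient topology. -/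
instance : TopologicalSpace (CP n) := TopologicalSpace.coinduced mk inferInstance

/-- The Hopf fibration `Π : S^{2n+1} → ℂP^n`, `Π(z) = [z]`. -/
def hopf (z : USphere n) : CP n := mk ⟨z, ne_zero_of_mem_unit_sphere z⟩

theorem mk_surjective : Function.Surjective (mk (n := n)) :=
  fun x => ⟨⟨Projectivization.rep x, Projectivization.rep_nonzero x⟩, Projectivization.mk_rep x⟩

theorem isQuotientMap_mk : IsQuotientMap (mk (n := n)) := ⟨⟨rfl⟩, mk_surjective⟩

theorem mk_eq_mk_iff (v w : {v : CSpace (n + 1) // v ≠ 0}) :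
    mk v = mk w ↔ ∃ a : ℂ, a • (w : CSpace (n + 1)) = v :=
  Projectivization.mk_eq_mk_iff' ℂ v.1 w.1 v.2 w.2

/-- The affine chart domain `U_i = {[z] : z_i ≠ 0}`. -/
def affineDomain (i : Fin (n + 1)) : Set (CP n) :=
  {x | (Projectivization.rep x : CSpace (n + 1)) i ≠ 0}

/-- The affine coordinates `[z] ↦ (z_j / z_i)_{j ≠ i}`. -/
def affineCoord (i : Fin (n + 1)) (x : CP n) : CSpace n :=
  WithLp.toLp 2 fun j =>
    (Projectivization.rep x : CSpace (n + 1)) (i.succAbove j)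
      / (Projectivization.rep x : CSpace (n + 1)) i

/-- The vector of `ℂ^{n+1}` whose `i`-th coordinate is `1` and whose other coordinates are those
of `w`. -/
def homogenize (i : Fin (n + 1)) (w : CSpace n) : CSpace (n + 1) :=
  WithLp.toLp 2 (i.insertNth (α := fun _ => ℂ) 1 w.ofLp)

theorem homogenize_self (i : Fin (n + 1)) (w : CSpace n) : homogenize i w i = 1 := by
  simp [homogenize]

theorem homogenize_succAbove (i : Fin (n + 1)) (w : CSpace n) (j : Fin n) :
    homogenize i w (i.succAbove j) = w j := by
  simp [homogenize]

theorem homogenize_ne_zero (i : Fin (n + 1)) (w : CSpace n) : homogenize i w ≠ 0 := fun h => by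
  have := homogenize_self i w
  simp [h] at this

theorem exists_rep_mk (v : {v : CSpace (n + 1) // v ≠ 0}) :
    ∃ a : ℂ, a ≠ 0 ∧ (Projectivization.rep (mk v) : CSpace (n + 1)) = a • v.1 := by
  obtain ⟨a, ha⟩ := Projectivization.exists_smul_eq_mk_rep ℂ v.1 v.2
  exact ⟨a, a.ne_zero, ha.symm⟩

theorem mk_mem_affineDomain (i : Fin (n + 1)) (v : {v : CSpace (n + 1) // v ≠ 0}) :
    mk v ∈ affineDomain i ↔ v.1 i ≠ 0 := by
  obtain ⟨a, ha, h⟩ := exists_rep_mk v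
  simp [affineDomain, h, ha]

theorem affineCoord_mk (i : Fin (n + 1)) (v : {v : CSpace (n + 1) // v ≠ 0}) :
    affineCoord i (mk v) = WithLp.toLp 2 fun j => v.1 (i.succAbove j) / v.1 i := by
  obtain ⟨a, ha, h⟩ := exists_rep_mk v
  ext j
  simp [affineCoord, h, mul_div_mul_left _ _ ha]

theorem contDiff_homogenize {𝕜 : Type*} [NontriviallyNormedField 𝕜] [NormedAlgebra 𝕜 ℂ]
    (i : Fin (n + 1)) : ContDiff 𝕜 ω (homogenize (n := n) i) := by
  rw [contDiff_piLp]
  intro k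
  rcases Fin.eq_self_or_eq_succAbove i k with rfl | ⟨j, rfl⟩
  · simp only [homogenize_self]
    exact contDiff_const
  · simp only [homogenize_succAbove]
    exact contDiff_piLp_apply 2

theorem isOpen_affineDomain (i : Fin (n + 1)) : IsOpen (affineDomain i) := by
  rw [← isQuotientMap_mk.isOpen_preimage]
  have : mk ⁻¹' affineDomain i = {v : {v : CSpace (n + 1) // v ≠ 0} | v.1 i ≠ 0} := by
    ext v
    simp [mk_mem_affineDomain]
  rw [this]
  exact isOpen_ne_fun (by fun_prop) continuous_const

/-- The affine chart `U_i → ℂ^n`. -/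
def affineChart (i : Fin (n + 1)) : OpenPartialHomeomorph (CP n) (CSpace n) where
  toFun := affineCoord i
  invFun w := mk ⟨homogenize i w, homogenize_ne_zero i w⟩
  source := affineDomain i
  target := univ
  map_source' _ _ := mem_univ _
  map_target' w _ := by simp [mk_mem_affineDomain, homogenize_self]
  left_inv' x hx := by
    obtain ⟨v, rfl⟩ := mk_surjective x
    rw [mk_mem_affineDomain] at hx
    rw [mk_eq_mk_iff]
    refine ⟨(v.1 i)⁻¹, ?_⟩
    ext k
    rcases Fin.eq_self_or_eq_succAbove i k with rfl | ⟨j, rfl⟩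
    · simp [homogenize_self, hx]
    · simp [homogenize_succAbove, affineCoord_mk, div_eq_inv_mul]
  right_inv' w _ := by
    ext j
    simp [affineCoord_mk, homogenize_self, homogenize_succAbove]
  open_source := isOpen_affineDomain i
  open_target := isOpen_univ
  continuousOn_toFun := by
    rw [isQuotientMap_mk.continuousOn_isOpen_iff (isOpen_affineDomain i)]
    have : affineCoord i ∘ mk = fun v : {v : CSpace (n + 1) // v ≠ 0} =>
        (WithLp.toLp 2 fun j => v.1 (i.succAbove j) / v.1 i : CSpace n) := by
      ext v
      simp [affineCoord_mk]
    rw [this]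
    refine (PiLp.continuous_toLp 2 _).comp_continuousOn (continuousOn_pi.2 fun j => ?_)
    refine ContinuousOn.div (by fun_prop) (by fun_prop) fun v hv => ?_
    exact (mk_mem_affineDomain i v).1 hv
  continuousOn_invFun := by
    refine (isQuotientMap_mk.continuous.comp ?_).continuousOn
    exact (contDiff_homogenize (𝕜 := ℂ) i).continuous.subtype_mk _

theorem exists_mem_affineDomain (x : CP n) : ∃ i, x ∈ affineDomain i := by
  by_contra! h
  refine Projectivization.rep_nonzero x ?_
  ext i
  simpa [affineDomain] using h i

/-- The atlas of the affine charts. -/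
instance : ChartedSpace (CSpace n) (CP n) where
  atlas := range affineChart
  chartAt x := affineChart (exists_mem_affineDomain x).choose
  mem_chart_source x := (exists_mem_affineDomain x).choose_spec
  chart_mem_atlas _ := mem_range_self _

theorem contDiffOn_transition {𝕜 : Type*} [NontriviallyNormedField 𝕜] [NormedAlgebra 𝕜 ℂ]
    (i j : Fin (n + 1)) :
    ContDiffOn 𝕜 ω ((affineChart i).symm.trans (affineChart j))
      ((affineChart i).symm.trans (affineChart j)).source := by
  have h : ∀ w, ((affineChart i).symm.trans (affineChart j)) w =
      WithLp.toLp 2 fun k => homogenize i w (j.succAbove k) * (homogenize i w j)⁻¹ := fun w => by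
    change affineCoord j (mk _) = _
    simp [affineCoord_mk, div_eq_mul_inv]
  have hc : ∀ k, ContDiff 𝕜 ω fun w : CSpace n => homogenize i w k :=
    fun k => (contDiff_piLp_apply 2).comp (contDiff_homogenize i)
  rw [contDiffOn_congr fun w _ => h w]
  rw [contDiffOn_piLp]
  intro k
  refine (hc _).contDiffOn.mul ((hc _).contDiffOn.inv fun w hw => ?_)
  exact (mk_mem_affineDomain j _).1 hw.2

/-- `ℂP^n` is a complex manifold. -/
instance : IsManifold 𝓘(ℂ, CSpace n) ω (CP n) := by
  refine isManifold_of_contDiffOn _ _ _ ?_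
  rintro _ _ ⟨i, rfl⟩ ⟨j, rfl⟩
  simpa using contDiffOn_transition i j

/-- `ℂP^n` is a smooth real manifold. -/
instance : IsManifold 𝓘(ℝ, CSpace n) ω (CP n) := by
  refine isManifold_of_contDiffOn _ _ _ ?_
  rintro _ _ ⟨i, rfl⟩ ⟨j, rfl⟩
  simpa using contDiffOn_transition i j

end CP

/-- The Fubini-Study metric of constant holomorphic sectional curvature `4`, in affine coordinates:
it has the same expression in each of the affine charts. The complex structure `J` is the
multiplication by `i` in these (holomorphic) charts. -/
def fubiniStudy {n : ℕ} (w u v : CSpace n) : ℝ :=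
  (((1 + ‖w‖ ^ 2 : ℝ) * inner ℂ u v - inner ℂ u w * inner ℂ w v) / ((1 + ‖w‖ ^ 2 : ℝ) : ℂ) ^ 2).re

/-- The Kähler form `ω(u, v) = ⟨J u, v⟩` of the Fubini-Study metric, in affine coordinates. -/
def fubiniStudyForm {n : ℕ} (w u v : CSpace n) : ℝ := fubiniStudy w (Complex.I • u) v

/-- The Euclidean scalar product of `ℂ^n`, at each point of `ℂ^n`. -/
def euclidean {n : ℕ} (_ u v : CSpace n) : ℝ := (inner ℂ u v).re

/-- The Liouville form `Λ_z(v) = ⟨v, J z⟩`. -/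
def liouville {n : ℕ} (z v : CSpace n) : ℝ := (inner ℂ v (Complex.I • z)).re

section Immersions

variable {E H M : Type*} [NormedAddCommGroup E] [NormedSpace ℝ E] [FiniteDimensional ℝ E]
  [TopologicalSpace H] (I : ModelWithCorners ℝ E H) [TopologicalSpace M] [ChartedSpace H M]
  {n : ℕ}

/-! ### Legendrian immersions in the sphere

Manifolds are without boundary: these notions are used for a boundaryless model `I`. -/

/-- `φ` is a (smooth) Legendrian immersion of the `n`-dimensional manifold `M`: `φ^* Λ = 0`. -/
structure IsLegendrianImmersion (φ : M → USphere n) : Prop where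
  finrank_eq : finrank ℝ E = n
  contMDiff : ContMDiff I 𝓘(ℝ, CSpace (n + 1)) ∞ (fun p => (φ p : CSpace (n + 1)))
  injective_mfderiv : ∀ p, Function.Injective
    (mfderiv I 𝓘(ℝ, CSpace (n + 1)) (fun p => (φ p : CSpace (n + 1))) p)
  liouville_eq_zero : ∀ (p : M) (v : TangentSpace I p), liouville (φ p : CSpace (n + 1))
    (mfderiv I 𝓘(ℝ, CSpace (n + 1)) (fun p => (φ p : CSpace (n + 1))) p v) = 0

/-- The expression of `φ : M → S^{2n+1} ⊆ ℂ^{n+1}` in the chart of `M` at `p`. -/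
def sphereLocal (φ : M → USphere n) (p : M) (x : E) : CSpace (n + 1) :=
  φ ((extChartAt I p).symm x)

/-- The mean curvature vector in the unit sphere of an immersion `f` in the unit sphere: the
component tangent to the sphere of the mean curvature vector of `f` in the Euclidean space. -/
def sphereMeanCurvature (f : E → CSpace (n + 1)) (x : E) : CSpace (n + 1) :=
  meanCurvature euclidean f x - euclidean (f x) (meanCurvature euclidean f x) (f x) • f x

/-- The immersion `φ` in the sphere is minimal: `H = 0`. -/
def IsMinimalInSphere (φ : M → USphere n) : Prop :=
  ∀ p, sphereMeanCurvature (sphereLocal I φ p) (extChartAt I p p) = 0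

/-- The vector field `J H` of a Legendrian immersion `f`, as a vector field on the domain of `f`
(`J H` is tangent to a Legendrian immersion, so it is the image under `df` of this field). -/
def sphereJH (f : E → CSpace (n + 1)) (x : E) : E :=
  tangentPart (euclidean (f x)) (fderiv ℝ f x) (Complex.I • sphereMeanCurvature f x)

/-- The Legendrian immersion `φ` is contact minimal (C-minimal): `div JH = 0`, where `div` is the
divergence for the induced metric. -/
def IsCMinimal (φ : M → USphere n) : Prop :=
  ∀ p, divergence (inducedMetric euclidean (sphereLocal I φ p)) (sphereJH (sphereLocal I φ p))
    (extChartAt I p p) = 0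

/-! ### Lagrangian immersions in complex projective space -/

/-- `Φ` is a (smooth) Lagrangian immersion of the `n`-dimensional manifold `M`: `Φ^* ω = 0`.
The tangent space of `ℂP^n` at `y` is identified with `ℂ^n` by the affine chart at `y`. -/
structure IsLagrangianImmersion (Φ : M → CP n) : Prop where
  finrank_eq : finrank ℝ E = n
  contMDiff : ContMDiff I 𝓘(ℝ, CSpace n) ∞ Φ
  injective_mfderiv : ∀ p, Function.Injective (mfderiv I 𝓘(ℝ, CSpace n) Φ p)
  form_eq_zero : ∀ (p : M) (u v : TangentSpace I p),
    fubiniStudyForm (chartAt (CSpace n) (Φ p) (Φ p))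
      (mfderiv I 𝓘(ℝ, CSpace n) Φ p u) (mfderiv I 𝓘(ℝ, CSpace n) Φ p v) = 0

/-- The expression of `Φ : M → ℂP^n` in the chart of `M` at `p` and the affine chart of `ℂP^n`
at `Φ p`. -/
def projLocal (Φ : M → CP n) (p : M) (x : E) : CSpace n :=
  chartAt (CSpace n) (Φ p) (Φ ((extChartAt I p).symm x))

/-- The immersion `Φ` in `ℂP^n` is minimal: `H = 0`. -/
def IsMinimalInCP (Φ : M → CP n) : Prop :=
  ∀ p, meanCurvature fubiniStudy (projLocal I Φ p) (extChartAt I p p) = 0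

/-- The vector field `J H` of a Lagrangian immersion `f`, as a vector field on the domain of `f`
(`J H` is tangent to a Lagrangian immersion, so it is the image under `df` of this field). -/
def projJH (f : E → CSpace n) (x : E) : E :=
  tangentPart (fubiniStudy (f x)) (fderiv ℝ f x) (Complex.I • meanCurvature fubiniStudy f x)

/-- The Lagrangian immersion `Φ` is Hamiltonian minimal (H-minimal): `div JH = 0`, where `div` is
the divergence for the induced metric. -/
def IsHMinimal (Φ : M → CP n) : Prop :=
  ∀ p, divergence (inducedMetric fubiniStudy (projLocal I Φ p)) (projJH (projLocal I Φ p))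
    (extChartAt I p p) = 0

end Immersions

/-! ### The map of the theorem -/

/-- The vector `(a x, b y)` of `ℂ^{n₁+1} × ℂ^{n₂+1} = ℂ^{n+1}`, `n = n₁ + n₂ + 1`. -/
def pairVec {n₁ n₂ : ℕ} (a b : ℂ) (x : CSpace (n₁ + 1)) (y : CSpace (n₂ + 1)) :
    CSpace (n₁ + n₂ + 1 + 1) :=
  WithLp.toLp 2 fun k =>
    Fin.append (a • x).ofLp (b • y).ofLp (k.cast (by omega : n₁ + n₂ + 1 + 1 = n₁ + 1 + (n₂ + 1)))

theorem norm_pairVec_sq {n₁ n₂ : ℕ} (a b : ℂ) (x : CSpace (n₁ + 1)) (y : CSpace (n₂ + 1)) :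
    ‖pairVec a b x y‖ ^ 2 = ‖a‖ ^ 2 * ‖x‖ ^ 2 + ‖b‖ ^ 2 * ‖y‖ ^ 2 := by
  have h : n₁ + n₂ + 1 + 1 = n₁ + 1 + (n₂ + 1) := by omega
  simp only [EuclideanSpace.norm_sq_eq, Finset.mul_sum, pairVec]
  rw [← Equiv.sum_comp (finCongr h.symm), Fin.sum_univ_add]
  simp [mul_pow]

/-- The point
`(cos δ exp(i s sin² δ) x, sin δ exp(-i s cos² δ) y)` of `S^{2n+1}`, `n = n₁ + n₂ + 1`. -/
def liftPoint {n₁ n₂ : ℕ} (δ s : ℝ) (x : USphere n₁) (y : USphere n₂) : USphere (n₁ + n₂ + 1) :=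
  ⟨pairVec (Real.cos δ * Complex.exp (Complex.I * s * Real.sin δ ^ 2))
      (Real.sin δ * Complex.exp (-(Complex.I * s * Real.cos δ ^ 2))) x y, by
    rw [mem_sphere_zero_iff_norm]
    have hx : ‖(x : CSpace (n₁ + 1))‖ = 1 := norm_eq_of_mem_sphere x
    have hy : ‖(y : CSpace (n₂ + 1))‖ = 1 := norm_eq_of_mem_sphere y
    have h1 : ‖Complex.exp (Complex.I * s * Real.sin δ ^ 2)‖ = 1 := by
      have := Complex.norm_exp_ofReal_mul_I (s * Real.sin δ ^ 2)
      rw [← this]; push_cast; ring_nf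
    have h2 : ‖Complex.exp (-(Complex.I * s * Real.cos δ ^ 2))‖ = 1 := by
      have := Complex.norm_exp_ofReal_mul_I (-(s * Real.cos δ ^ 2))
      rw [← this]; push_cast; ring_nf
    rw [← pow_left_inj₀ (norm_nonneg _) zero_le_one two_ne_zero, norm_pairVec_sq]
    simp only [norm_mul, h1, h2, hx, hy, Complex.norm_real, Real.norm_eq_abs, mul_one, sq_abs,
      one_pow]
    exact Real.cos_sq_add_sin_sq δ⟩

end LagrangianCP

end

/-! The map is governed by the lift F(s, p, q) = (cos δ e^{is sin²δ} ψ₁(p), sin δ e^{-is cos²δ}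
ψ₂(q)) to the sphere. The two phases are chosen so that ⟨F, ∂ₛF⟩ = i(cos²δ sin²δ - sin²δ cos²δ) = 0.
Hence F is Hermitian-orthogonal to its derivatives, i.e. Legendrian (`legendrianOn_productLift`). On
vectors orthogonal to F the Hopf projection is isometric (`fubiniStudyHermitian_affineProjDeriv`).
So F and its projection have the same induced metric, their second fundamental forms correspond
(`secondFundamentalForm_fubiniStudy`), and JH is the same vector field on the domain. The projection
is therefore Lagrangian, and everything can be read off from the mean form α_F(w) = ⟨JH, F_*w⟩ of
the lift.

The induced metric is the product cos²δ sin²δ ds² + cos²δ g₁ + sin²δ g₂. The trace of the cubic form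
Im⟨D²F(u, v), F_*w⟩ is (`finrank_mul_meanForm_productLift`) n α_F = (cos²δ (n₂ + 1) - sin²δ (n₁ +
1)) ds + n₁ α₁ + n₂ α₂. The three terms live on different factors, so α_F vanishes exactly when ψ₁
and ψ₂ are minimal and tan²δ = (n₂ + 1)/(n₁ + 1). The dual field JH is a constant multiple of ∂ₛ
plus constant multiples of JH₁ and JH₂. As ∂ₛ is divergence-free, div JH is a combination of div JH₁
and div JH₂ (`divergence_productLift`), which gives H-minimality.

The lift itself is not a function of e^{is}. Multiplied by the unit scalar e^{is cos²δ}, which does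
not change the projective class, it becomes (cos δ e^{is} ψ₁, sin δ ψ₂), and this is: whence the
globally defined `torusMap`. Around each point a local branch of the angle (`exists_phase`) recovers
the lift. -/

set_option linter.unusedSectionVars false

noncomputable section

namespace LagrangianCP

/-! ### Scalar products, metric traces and Gram determinants, also on products. -/

section ScalarProducts

variable {E E₁ E₂ F : Type*} [NormedAddCommGroup E] [NormedSpace ℝ E] [FiniteDimensional ℝ E]
  [NormedAddCommGroup E₁] [NormedSpace ℝ E₁] [FiniteDimensional ℝ E₁]
  [NormedAddCommGroup E₂] [NormedSpace ℝ E₂] [FiniteDimensional ℝ E₂]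
  [NormedAddCommGroup F] [NormedSpace ℝ F]

/-- `g` is a positive definite symmetric bilinear form. -/
structure IsScalarProduct (g : E → E → ℝ) : Prop where
  add_left : ∀ u u' v, g (u + u') v = g u v + g u' v
  smul_left : ∀ (c : ℝ) u v, g (c • u) v = c * g u v
  symm : ∀ u v, g u v = g v u
  pos : ∀ u, u ≠ 0 → 0 < g u u

namespace IsScalarProduct

variable {g : E → E → ℝ} (hg : IsScalarProduct g)
include hg

/-- The bilinear form given by a scalar product. -/
def bilin : LinearMap.BilinForm ℝ E :=
  LinearMap.mk₂ ℝ g hg.add_left hg.smul_left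
    (fun u v w => by rw [hg.symm, hg.add_left, hg.symm v, hg.symm w])
    (fun c u v => by rw [hg.symm, hg.smul_left, hg.symm v, smul_eq_mul])

theorem bilin_apply (u v : E) : hg.bilin u v = g u v := rfl

theorem gram_eq : gram g = LinearMap.BilinForm.toMatrix (finBasis ℝ E) hg.bilin := by
  ext i j
  simp [gram, LinearMap.BilinForm.toMatrix_apply, bilin_apply]

theorem ext_left {u u' : E} (h : ∀ v, g u v = g u' v) : u = u' := by
  by_contra hne
  have h1 := hg.pos (u - u') (sub_ne_zero.2 hne)
  have h2 : g (u - u') (u - u') = hg.bilin u (u - u') - hg.bilin u' (u - u') := by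
    rw [← LinearMap.sub_apply, ← map_sub, bilin_apply]
  rw [h2, bilin_apply, bilin_apply, h, sub_self] at h1
  exact lt_irrefl _ h1

theorem posDef_gram : (gram g).PosDef := by
  refine .of_dotProduct_mulVec_pos ?_ fun x hx => ?_
  · ext i j
    simp [gram, hg.symm]
  · have hu : ∑ i, x i • finBasis ℝ E i ≠ 0 := fun h =>
      hx (funext fun i => Fintype.linearIndependent_iff.1 (finBasis ℝ E).linearIndependent x h i)
    have h := hg.pos _ hu
    rw [← hg.bilin_apply] at h
    simp only [map_sum, map_smul, LinearMap.sum_apply, LinearMap.smul_apply, smul_eq_mul,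
      bilin_apply, Finset.mul_sum] at h
    simpa [dotProduct, Matrix.mulVec, gram, Finset.mul_sum, mul_comm, mul_left_comm] using
      Finset.sum_comm.trans_gt h

theorem det_gram_pos : 0 < (gram g).det := hg.posDef_gram.det_pos

theorem isUnit_det_gram : IsUnit (gram g).det := hg.det_gram_pos.ne'.isUnit

theorem apply_sharp (α : E →ₗ[ℝ] ℝ) (v : E) : g (sharp g α) v = α v := by
  suffices h : hg.bilin (sharp g α) = α from LinearMap.congr_fun h v
  refine (finBasis ℝ E).ext fun k => ?_
  have h1 : ∀ j, ∑ i, (gram g)⁻¹ i j * gram g i k = if j = k then 1 else 0 := fun j => by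
    have h4 := congrFun (congrFun (Matrix.mul_nonsing_inv (gram g) hg.isUnit_det_gram) k) j
    rw [Matrix.mul_apply, Matrix.one_apply] at h4
    simp only [eq_comm (a := j) (b := k), ← h4]
    refine Finset.sum_congr rfl fun i _ => ?_
    rw [mul_comm]
    congr 1
    exact hg.symm _ _
  simp only [sharp, map_sum, map_smul, LinearMap.sum_apply, LinearMap.smul_apply, smul_eq_mul,
    bilin_apply]
  calc ∑ i, ∑ j, (gram g)⁻¹ i j * α (finBasis ℝ E j) * g (finBasis ℝ E i) (finBasis ℝ E k)
      = ∑ j, ∑ i, α (finBasis ℝ E j) * ((gram g)⁻¹ i j * gram g i k) := by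
        rw [Finset.sum_comm]
        refine Finset.sum_congr rfl fun j _ => Finset.sum_congr rfl fun i _ => ?_
        simp only [gram, Matrix.of_apply]
        ring
    _ = α (finBasis ℝ E k) := by
        simp only [← Finset.mul_sum, h1]
        simp

theorem sharp_eq {α : E → ℝ} {X : E} (h : ∀ v, g X v = α v) : sharp g α = X := by
  have h1 : α = hg.bilin X := funext fun v => (h v).symm
  refine hg.ext_left fun v => ?_
  rw [h1, hg.apply_sharp, bilin_apply]

/-- The metric trace of a bilinear form `B` is the trace of the endomorphism `L` that represents
it. -/
theorem metricTrace_eq_trace {B : E → E → ℝ} (L : E →ₗ[ℝ] E) (h : ∀ u v, g (L u) v = B u v) :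
    metricTrace g B = LinearMap.trace ℝ E L := by
  rw [LinearMap.trace_eq_matrix_trace ℝ (finBasis ℝ E), Matrix.trace, metricTrace]
  refine Finset.sum_congr rfl fun i _ => ?_
  rw [Matrix.diag_apply, LinearMap.toMatrix_apply, ← hg.sharp_eq (h _)]
  simp [sharp, Finsupp.single_apply]

theorem exists_representing (B : E →ₗ[ℝ] E →ₗ[ℝ] ℝ) :
    ∃ L : E →ₗ[ℝ] E, ∀ u v, g (L u) v = B u v := by
  refine ⟨⟨⟨fun u => sharp g (B u), fun u v => ?_⟩, fun c u => ?_⟩, fun u v => hg.apply_sharp _ _⟩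
  · refine hg.sharp_eq fun w => ?_
    rw [hg.add_left, hg.apply_sharp, hg.apply_sharp, map_add, LinearMap.add_apply]
  · refine hg.sharp_eq fun w => ?_
    rw [RingHom.id_apply, hg.smul_left, hg.apply_sharp, map_smul, LinearMap.smul_apply, smul_eq_mul]

theorem const_mul {c : ℝ} (hc : 0 < c) : IsScalarProduct fun u v => c * g u v where
  add_left u u' v := by rw [hg.add_left, mul_add]
  smul_left a u v := by rw [hg.smul_left]; ring
  symm u v := by rw [hg.symm]
  pos u hu := mul_pos hc (hg.pos u hu)

omit hg in
theorem prod {g₁ : E₁ → E₁ → ℝ} {g₂ : E₂ → E₂ → ℝ} (h₁ : IsScalarProduct g₁)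
    (h₂ : IsScalarProduct g₂) :
    IsScalarProduct fun u v : E₁ × E₂ => g₁ u.1 v.1 + g₂ u.2 v.2 where
  add_left u u' v := by simp only [Prod.fst_add, Prod.snd_add, h₁.add_left, h₂.add_left]; ring
  smul_left c u v := by simp only [Prod.smul_fst, Prod.smul_snd, h₁.smul_left, h₂.smul_left]; ring
  symm u v := by rw [h₁.symm, h₂.symm]
  pos u hu := by
    have n₁ : 0 ≤ g₁ u.1 u.1 := by
      rcases eq_or_ne u.1 0 with h | h
      · have := h₁.smul_left 0 0 0
        simp only [zero_smul, zero_mul] at this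
        rw [h, this]
      · exact (h₁.pos _ h).le
    have n₂ : 0 ≤ g₂ u.2 u.2 := by
      rcases eq_or_ne u.2 0 with h | h
      · have := h₂.smul_left 0 0 0
        simp only [zero_smul, zero_mul] at this
        rw [h, this]
      · exact (h₂.pos _ h).le
    by_cases h : u.1 = 0
    · exact add_pos_of_nonneg_of_pos n₁ (h₂.pos _ fun h' => hu (Prod.ext h h'))
    · exact add_pos_of_pos_of_nonneg (h₁.pos _ h) n₂

end IsScalarProduct

theorem trace_prod (L : E₁ × E₂ →ₗ[ℝ] E₁ × E₂) :
    LinearMap.trace ℝ _ L =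
      LinearMap.trace ℝ _ (LinearMap.fst ℝ E₁ E₂ ∘ₗ L ∘ₗ LinearMap.inl ℝ E₁ E₂) +
        LinearMap.trace ℝ _ (LinearMap.snd ℝ E₁ E₂ ∘ₗ L ∘ₗ LinearMap.inr ℝ E₁ E₂) := by
  rw [LinearMap.trace_eq_matrix_trace ℝ ((finBasis ℝ E₁).prod (finBasis ℝ E₂)),
    LinearMap.trace_eq_matrix_trace ℝ (finBasis ℝ E₁),
    LinearMap.trace_eq_matrix_trace ℝ (finBasis ℝ E₂)]
  simp [Matrix.trace, LinearMap.toMatrix_apply, Fintype.sum_sum_type]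

/-- `finBasis` of a product is unrelated to the bases of the factors, so the sums cannot be compared
term by term. Passing to the trace of the representing endomorphism removes the basis, and only its
diagonal blocks count. -/
theorem metricTrace_prod {g₁ : E₁ → E₁ → ℝ} {g₂ : E₂ → E₂ → ℝ} (h₁ : IsScalarProduct g₁)
    (h₂ : IsScalarProduct g₂) (B : E₁ × E₂ →ₗ[ℝ] E₁ × E₂ →ₗ[ℝ] ℝ) :
    metricTrace (fun u v : E₁ × E₂ => g₁ u.1 v.1 + g₂ u.2 v.2) (fun u v => B u v) =
      metricTrace g₁ (fun u v => B (u, 0) (v, 0)) + metricTrace g₂ (fun u v => B (0, u) (0, v)) := by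
  obtain ⟨L, hL⟩ := (h₁.prod h₂).exists_representing B
  have z₁ : ∀ u, g₁ u 0 = 0 := fun u => by
    rw [h₁.symm, ← zero_smul ℝ (0 : E₁), h₁.smul_left, zero_mul]
  have z₂ : ∀ u, g₂ u 0 = 0 := fun u => by
    rw [h₂.symm, ← zero_smul ℝ (0 : E₂), h₂.smul_left, zero_mul]
  rw [(h₁.prod h₂).metricTrace_eq_trace L hL, trace_prod,
    h₁.metricTrace_eq_trace (LinearMap.fst ℝ E₁ E₂ ∘ₗ L ∘ₗ LinearMap.inl ℝ E₁ E₂) fun u v => ?_,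
    h₂.metricTrace_eq_trace (LinearMap.snd ℝ E₁ E₂ ∘ₗ L ∘ₗ LinearMap.inr ℝ E₁ E₂) fun u v => ?_]
  · simpa [z₁] using hL (0, u) (0, v)
  · simpa [z₂] using hL (u, 0) (v, 0)

-- The constant `k` is the squared determinant of a change of basis, from the product basis to
-- `finBasis` of the product. It does not depend on the metrics, hence not on the point, and so it
-- drops out of a divergence.
variable (E₁ E₂) in
theorem exists_det_gram_prod : ∃ k : ℝ, 0 < k ∧ ∀ (g₁ : E₁ → E₁ → ℝ) (g₂ : E₂ → E₂ → ℝ),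
    IsScalarProduct g₁ → IsScalarProduct g₂ →
      (gram fun u v : E₁ × E₂ => g₁ u.1 v.1 + g₂ u.2 v.2).det =
        k * ((gram g₁).det * (gram g₂).det) := by
  set b := (finBasis ℝ E₁).prod (finBasis ℝ E₂) with hb
  set b' := finBasis ℝ (E₁ × E₂)
  have hcard : Fintype.card (Fin (finrank ℝ (E₁ × E₂))) =
      Fintype.card (Fin (finrank ℝ E₁) ⊕ Fin (finrank ℝ E₂)) := by
    simp [finrank_prod]
  let e := Fintype.equivOfCardEq hcard
  let c := b.reindex e.symm
  have hc : IsUnit (c.toMatrix b').det := by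
    rw [← Basis.det_apply]
    exact c.isUnit_det b'
  refine ⟨(c.toMatrix b').det ^ 2, by have := hc.ne_zero; positivity, fun g₁ g₂ h₁ h₂ => ?_⟩
  have z₁ : ∀ u, g₁ u 0 = 0 := fun u => by
    rw [h₁.symm, ← zero_smul ℝ (0 : E₁), h₁.smul_left, zero_mul]
  have z₂ : ∀ u, g₂ u 0 = 0 := fun u => by
    rw [h₂.symm, ← zero_smul ℝ (0 : E₂), h₂.smul_left, zero_mul]
  have hblock : LinearMap.BilinForm.toMatrix c (h₁.prod h₂).bilin =
      (Matrix.fromBlocks (gram g₁) 0 0 (gram g₂)).submatrix e e := by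
    ext i j
    simp only [LinearMap.BilinForm.toMatrix_apply, IsScalarProduct.bilin_apply, c, Basis.reindex_apply,
      Equiv.symm_symm, Matrix.submatrix_apply, hb, Basis.prod_apply]
    rcases e i with i' | i' <;> rcases e j with j' | j' <;>
      simp [gram, z₁, z₂, h₁.symm 0, h₂.symm 0]
  rw [(h₁.prod h₂).gram_eq, ← LinearMap.BilinForm.toMatrix_mul_basis_toMatrix c, hblock,
    Matrix.det_mul, Matrix.det_mul, Matrix.det_transpose, Matrix.det_submatrix_equiv_self,
    Matrix.det_fromBlocks_zero₂₁]
  ring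

theorem det_gram_const_mul (c : ℝ) (g : E → E → ℝ) :
    (gram fun u v => c * g u v).det = c ^ finrank ℝ E * (gram g).det := by
  have : (gram fun u v => c * g u v) = c • gram g := by ext; simp [gram]
  rw [this, Matrix.det_smul, Fintype.card_fin]

end ScalarProducts

/-! ### Divergence of vector fields: scaling and products. -/

section Divergence

variable {E E₁ E₂ : Type*} [NormedAddCommGroup E] [NormedSpace ℝ E] [FiniteDimensional ℝ E]
  [NormedAddCommGroup E₁] [NormedSpace ℝ E₁] [FiniteDimensional ℝ E₁]
  [NormedAddCommGroup E₂] [NormedSpace ℝ E₂] [FiniteDimensional ℝ E₂]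

/-- This form of the divergence is free of coordinates apart from the density. `V` need only agree
with the weighted field near `x`, so that a formula valid on an open set can be substituted. -/
theorem divergence_eq_trace {g : E → E → E → ℝ} {X V : E → E} {x : E}
    (hV : (fun z => √(gram (g z)).det • X z) =ᶠ[𝓝 x] V) (hd : DifferentiableAt ℝ V x) :
    divergence g X x = (√(gram (g x)).det)⁻¹ * LinearMap.trace ℝ E (fderiv ℝ V x) := by
  rw [divergence, LinearMap.trace_eq_matrix_trace ℝ (finBasis ℝ E), Matrix.trace]
  congr 1
  refine Finset.sum_congr rfl fun i _ => ?_
  have h1 : (fun z => √(gram (g z)).det * (finBasis ℝ E).coord i (X z)) =ᶠ[𝓝 x]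
      fun z => LinearMap.toContinuousLinearMap ((finBasis ℝ E).coord i) (V z) := by
    filter_upwards [hV] with z hz
    simp [← hz]
  have h2 := (LinearMap.toContinuousLinearMap ((finBasis ℝ E).coord i)).hasFDerivAt.comp x
    hd.hasFDerivAt
  simp only [Function.comp_def] at h2
  rw [h1.fderiv_eq, h2.fderiv, Matrix.diag_apply, LinearMap.toMatrix_apply]
  simp

theorem divergence_const_smul (g : E → E → E → ℝ) (c : ℝ) {X : E → E} {x : E}
    (hd : DifferentiableAt ℝ (fun z => √(gram (g z)).det • X z) x) :
    divergence g (fun z => c • X z) x = c * divergence g X x := by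
  have h : (fun z => √(gram (g z)).det • c • X z) = fun z => c • (√(gram (g z)).det • X z) :=
    funext fun z => smul_comm _ _ _
  rw [divergence_eq_trace (V := fun z => c • (√(gram (g z)).det • X z)) (by rw [h])
    (hd.const_smul c), divergence_eq_trace (by rfl) hd, fderiv_fun_const_smul hd]
  simp
  ring

theorem divergence_const_mul_metric (g : E → E → E → ℝ) {c : ℝ} (hc : 0 < c) {X : E → E} {x : E}
    (hd : DifferentiableAt ℝ (fun z => √(gram (g z)).det • X z) x) :
    divergence (fun z u v => c * g z u v) X x = divergence g X x := by
  have h0 : 0 < √(c ^ finrank ℝ E) := by positivity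
  have h1 : ∀ z, √(gram (fun u v => c * g z u v)).det = √(c ^ finrank ℝ E) * √(gram (g z)).det :=
    fun z => by rw [det_gram_const_mul, Real.sqrt_mul (by positivity)]
  rw [divergence_eq_trace (V := fun z => √(c ^ finrank ℝ E) • (√(gram (g z)).det • X z))
    (.of_forall fun z => by simp only [h1, mul_smul]) (hd.const_smul _),
    divergence_eq_trace (by rfl) hd, fderiv_fun_const_smul hd, h1]
  simp
  field_simp

theorem divergence_congr {g g' : E → E → E → ℝ} {X X' : E → E} {x : E} (hg : ∀ᶠ z in 𝓝 x, g z = g' z)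
    (hX : X =ᶠ[𝓝 x] X') : divergence g X x = divergence g' X' x := by
  rw [divergence, divergence, hg.self_of_nhds]
  congr 1
  refine Finset.sum_congr rfl fun i _ => ?_
  congr 1
  refine Filter.EventuallyEq.fderiv_eq ?_
  filter_upwards [hg, hX] with z h1 h2
  rw [h1, h2]

/-- Up to the constant √k the density is the product r₁ r₂ of the densities of the factors. Along
one factor the density of the other is constant, and it cancels against the prefactor of the
divergence. -/
theorem divergence_prod {g₁ : E₁ → E₁ → E₁ → ℝ} {g₂ : E₂ → E₂ → E₂ → ℝ} {X₁ : E₁ → E₁} {X₂ : E₂ → E₂}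
    {x : E₁ × E₂} (h₁ : ∀ᶠ z in 𝓝 x.1, IsScalarProduct (g₁ z))
    (h₂ : ∀ᶠ z in 𝓝 x.2, IsScalarProduct (g₂ z))
    (d₁ : DifferentiableAt ℝ (fun z => √(gram (g₁ z)).det) x.1)
    (d₂ : DifferentiableAt ℝ (fun z => √(gram (g₂ z)).det) x.2)
    (hX₁ : DifferentiableAt ℝ X₁ x.1) (hX₂ : DifferentiableAt ℝ X₂ x.2) :
    divergence (fun z u v : E₁ × E₂ => g₁ z.1 u.1 v.1 + g₂ z.2 u.2 v.2)
        (fun z => (X₁ z.1, X₂ z.2)) x =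
      divergence g₁ X₁ x.1 + divergence g₂ X₂ x.2 := by
  obtain ⟨k, hk, hdet⟩ := exists_det_gram_prod E₁ E₂
  have hs : ∀ᶠ z in 𝓝 x, √(gram fun u v : E₁ × E₂ => g₁ z.1 u.1 v.1 + g₂ z.2 u.2 v.2).det =
      √k * (√(gram (g₁ z.1)).det * √(gram (g₂ z.2)).det) := by
    filter_upwards [continuousAt_fst.eventually h₁, continuousAt_snd.eventually h₂] with z k₁ k₂
    rw [hdet _ _ k₁ k₂, Real.sqrt_mul hk.le, Real.sqrt_mul k₁.det_gram_pos.le]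
  set r₁ := fun z => √(gram (g₁ z)).det with hr₁
  set r₂ := fun z => √(gram (g₂ z)).det with hr₂
  have p₁ : 0 < r₁ x.1 := Real.sqrt_pos.2 h₁.self_of_nhds.det_gram_pos
  have p₂ : 0 < r₂ x.2 := Real.sqrt_pos.2 h₂.self_of_nhds.det_gram_pos
  have pk : 0 < √k := Real.sqrt_pos.2 hk
  set V : E₁ × E₂ → E₁ × E₂ := fun z => (√k * (r₁ z.1 * r₂ z.2)) • (X₁ z.1, X₂ z.2) with hV
  have e₁ : DifferentiableAt ℝ (fun z : E₁ × E₂ => r₁ z.1) x := d₁.comp x differentiableAt_fst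
  have e₂ : DifferentiableAt ℝ (fun z : E₁ × E₂ => r₂ z.2) x := d₂.comp x differentiableAt_snd
  have f₁ : DifferentiableAt ℝ (fun z : E₁ × E₂ => X₁ z.1) x := hX₁.comp x differentiableAt_fst
  have f₂ : DifferentiableAt ℝ (fun z : E₁ × E₂ => X₂ z.2) x := hX₂.comp x differentiableAt_snd
  have dV : DifferentiableAt ℝ V x := ((e₁.mul e₂).const_mul _).smul (f₁.prodMk f₂)
  have dY₁ : DifferentiableAt ℝ (fun z => r₁ z • X₁ z) x.1 := d₁.smul hX₁
  have dY₂ : DifferentiableAt ℝ (fun z => r₂ z • X₂ z) x.2 := d₂.smul hX₂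
  rw [divergence_eq_trace (V := V) (by filter_upwards [hs] with z hz; rw [hz]) dV,
    divergence_eq_trace (by rfl) dY₁, divergence_eq_trace (by rfl) dY₂, hs.self_of_nhds, trace_prod]
  have t₁ : (LinearMap.fst ℝ E₁ E₂ ∘ₗ (fderiv ℝ V x : E₁ × E₂ →ₗ[ℝ] E₁ × E₂) ∘ₗ
      LinearMap.inl ℝ E₁ E₂) = (√k * r₂ x.2) • (fderiv ℝ (fun z => r₁ z • X₁ z) x.1 : E₁ →ₗ[ℝ] E₁) := by
    have h := (hasFDerivAt_fst (𝕜 := ℝ)).comp x.1 ((dV.hasFDerivAt (x := (x.1, x.2))).comp x.1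
      (hasFDerivAt_prodMk_left (𝕜 := ℝ) x.1 x.2))
    have h' : (Prod.fst ∘ V ∘ fun z => (z, x.2)) = fun z => (√k * r₂ x.2) • (r₁ z • X₁ z) := by
      funext z
      simp only [Function.comp_apply, hV, Prod.smul_fst, smul_smul]
      ring_nf
    rw [h'] at h
    have h'' := congrArg (fun L : E₁ →L[ℝ] E₁ => (L : E₁ →ₗ[ℝ] E₁))
      (h.unique (dY₁.hasFDerivAt.const_smul (√k * r₂ x.2)))
    exact h''
  have t₂ : (LinearMap.snd ℝ E₁ E₂ ∘ₗ (fderiv ℝ V x : E₁ × E₂ →ₗ[ℝ] E₁ × E₂) ∘ₗ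
      LinearMap.inr ℝ E₁ E₂) = (√k * r₁ x.1) • (fderiv ℝ (fun z => r₂ z • X₂ z) x.2 : E₂ →ₗ[ℝ] E₂) := by
    have h := (hasFDerivAt_snd (𝕜 := ℝ)).comp x.2 ((dV.hasFDerivAt (x := (x.1, x.2))).comp x.2
      (hasFDerivAt_prodMk_right (𝕜 := ℝ) x.1 x.2))
    have h' : (Prod.snd ∘ V ∘ fun z => (x.1, z)) = fun z => (√k * r₁ x.1) • (r₂ z • X₂ z) := by
      funext z
      simp only [Function.comp_apply, hV, Prod.smul_snd, smul_smul]
      ring_nf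
    rw [h'] at h
    have h'' := congrArg (fun L : E₂ →L[ℝ] E₂ => (L : E₂ →ₗ[ℝ] E₂))
      (h.unique (dY₂.hasFDerivAt.const_smul (√k * r₁ x.1)))
    exact h''
  rw [t₁, t₂, map_smul, map_smul, smul_eq_mul, smul_eq_mul]
  change (√k * (r₁ x.1 * r₂ x.2))⁻¹ * _ = (r₁ x.1)⁻¹ * _ + (r₂ x.2)⁻¹ * _
  field_simp

end Divergence

/-! ### Real derivatives of complex-valued functions. -/

section ComplexCalculus

variable {E : Type*} [NormedAddCommGroup E] [NormedSpace ℝ E] {n : ℕ}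

theorem hasFDerivAt_div_complex {a b : E → ℂ} {x : E} (ha : DifferentiableAt ℝ a x)
    (hb : DifferentiableAt ℝ b x) (h0 : b x ≠ 0) :
    ∃ L : E →L[ℝ] ℂ, HasFDerivAt (fun z => a z / b z) L x ∧
      ∀ v, L v = (fderiv ℝ a x v * b x - a x * fderiv ℝ b x v) / b x ^ 2 := by
  have h := ha.hasFDerivAt.mul
    (((hasDerivAt_inv (𝕜 := ℂ) h0).hasFDerivAt.restrictScalars ℝ).comp x hb.hasFDerivAt)
  have he : (a * (Inv.inv ∘ b)) = fun z => a z / b z := funext fun z => (div_eq_mul_inv _ _).symm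
  rw [he] at h
  refine ⟨_, h, fun v => ?_⟩
  simp
  field_simp
  ring

theorem DifferentiableAt.div_complex {a b : E → ℂ} {x : E} (ha : DifferentiableAt ℝ a x)
    (hb : DifferentiableAt ℝ b x) (h0 : b x ≠ 0) : DifferentiableAt ℝ (fun z => a z / b z) x :=
  (hasFDerivAt_div_complex ha hb h0).choose_spec.1.differentiableAt

theorem fderiv_div_complex_apply {a b : E → ℂ} {x : E} (ha : DifferentiableAt ℝ a x)
    (hb : DifferentiableAt ℝ b x) (h0 : b x ≠ 0) (v : E) :
    fderiv ℝ (fun z => a z / b z) x v =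
      (fderiv ℝ a x v * b x - a x * fderiv ℝ b x v) / b x ^ 2 := by
  obtain ⟨L, hL, h⟩ := hasFDerivAt_div_complex ha hb h0
  rw [hL.fderiv, h]

theorem fderiv_mul_complex_apply {a b : E → ℂ} {x : E} (ha : DifferentiableAt ℝ a x)
    (hb : DifferentiableAt ℝ b x) (v : E) :
    fderiv ℝ (fun z => a z * b z) x v = a x * fderiv ℝ b x v + fderiv ℝ a x v * b x := by
  rw [fderiv_fun_mul ha hb]
  simp [mul_comm]

theorem fderiv_apply_coord {f : E → CSpace n} {x : E} (hf : DifferentiableAt ℝ f x) (v : E)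
    (j : Fin n) : fderiv ℝ (fun z => f z j) x v = fderiv ℝ f x v j := by
  have h := (((EuclideanSpace.proj j : CSpace n →L[ℂ] ℂ).restrictScalars ℝ).hasFDerivAt).comp x
    hf.hasFDerivAt
  have h' := h.fderiv
  simp only [Function.comp_def] at h'
  exact congrArg (fun L : E →L[ℝ] ℂ => L v) h'

theorem differentiableAt_coord {f : E → CSpace n} {x : E} (hf : DifferentiableAt ℝ f x) (j : Fin n) :
    DifferentiableAt ℝ (fun z => f z j) x :=
  differentiableAt_piLp 2 |>.1 hf j

theorem fderiv_re_apply {a : E → ℂ} {x : E} (ha : DifferentiableAt ℝ a x) (v : E) :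
    fderiv ℝ (fun z => (a z).re) x v = (fderiv ℝ a x v).re := by
  have h := (Complex.reCLM.hasFDerivAt.comp x ha.hasFDerivAt).fderiv
  simp only [Function.comp_def] at h
  exact congrArg (fun L : E →L[ℝ] ℝ => L v) h

end ComplexCalculus

/-! ### The Fubini-Study metric and its Levi-Civita connection. -/

section FubiniStudy

variable {n : ℕ}

theorem one_add_inner_self (y : CSpace n) : 1 + inner ℂ y y = ((1 + ‖y‖ ^ 2 : ℝ) : ℂ) := by
  rw [inner_self_eq_norm_sq_to_K]
  push_cast
  rfl

theorem one_add_inner_self_ne_zero (y : CSpace n) : (1 : ℂ) + inner ℂ y y ≠ 0 := by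
  rw [one_add_inner_self]
  exact_mod_cast (by positivity : (1 + ‖y‖ ^ 2 : ℝ) ≠ 0)

/-- The Hermitian form whose real part is the Fubini-Study metric. -/
def fubiniStudyHermitian (y u v : CSpace n) : ℂ :=
  ((1 + inner ℂ y y) * inner ℂ u v - inner ℂ u y * inner ℂ y v) / (1 + inner ℂ y y) ^ 2

theorem fubiniStudy_eq (y u v : CSpace n) : fubiniStudy y u v = (fubiniStudyHermitian y u v).re := by
  rw [fubiniStudyHermitian, one_add_inner_self]
  rfl

theorem conj_fubiniStudyHermitian (y u v : CSpace n) :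
    (starRingEnd ℂ) (fubiniStudyHermitian y u v) = fubiniStudyHermitian y v u := by
  simp only [fubiniStudyHermitian, map_div₀, map_sub, map_mul, map_pow, map_add, map_one,
    inner_conj_symm]
  ring

theorem fubiniStudyHermitian_add_left (y u u' v : CSpace n) :
    fubiniStudyHermitian y (u + u') v =
      fubiniStudyHermitian y u v + fubiniStudyHermitian y u' v := by
  simp only [fubiniStudyHermitian, inner_add_left]
  ring

theorem fubiniStudyHermitian_smul_left (c : ℂ) (y u v : CSpace n) :
    fubiniStudyHermitian y (c • u) v = (starRingEnd ℂ) c * fubiniStudyHermitian y u v := by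
  simp only [fubiniStudyHermitian, inner_smul_left]
  ring

theorem isScalarProduct_fubiniStudy (y : CSpace n) : IsScalarProduct (fubiniStudy y) where
  add_left u u' v := by simp only [fubiniStudy_eq, fubiniStudyHermitian_add_left, Complex.add_re]
  smul_left c u v := by
    rw [fubiniStudy_eq, fubiniStudy_eq, ← Complex.coe_smul c u, fubiniStudyHermitian_smul_left]
    simp
  symm u v := by rw [fubiniStudy_eq, fubiniStudy_eq, ← conj_fubiniStudyHermitian, Complex.conj_re]
  pos u hu := by
    -- By Cauchy-Schwarz the numerator (1 + |y|²)|u|² - |⟨y, u⟩|² is at least |u|².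
    have h1 : ‖inner ℂ y u‖ ≤ ‖y‖ * ‖u‖ := norm_inner_le_norm y u
    have h2 : inner ℂ u y * inner ℂ y u = ((‖inner ℂ y u‖ ^ 2 : ℝ) : ℂ) := by
      rw [← inner_conj_symm, mul_comm, Complex.mul_conj, Complex.normSq_eq_norm_sq]
    have h3 : inner ℂ u u = ((‖u‖ ^ 2 : ℝ) : ℂ) := by
      rw [inner_self_eq_norm_sq_to_K]
      push_cast
      rfl
    have h4 : 0 < ‖u‖ := norm_pos_iff.2 hu
    rw [fubiniStudy, h2, h3]
    norm_cast
    refine div_pos ?_ (by positivity)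
    have h5 : ‖inner ℂ y u‖ ^ 2 ≤ (‖y‖ * ‖u‖) ^ 2 := pow_le_pow_left₀ (norm_nonneg _) h1 2
    have h6 : 0 < ‖u‖ ^ 2 := by positivity
    nlinarith

theorem differentiable_inner_self : Differentiable ℝ fun z : CSpace n => (1 : ℂ) + inner ℂ z z :=
  fun _ => (DifferentiableAt.inner ℂ differentiableAt_id differentiableAt_id).const_add _

theorem differentiableAt_fubiniStudyHermitian (y u v : CSpace n) :
    DifferentiableAt ℝ (fun z => fubiniStudyHermitian z u v) y := by
  have hD := differentiable_inner_self (n := n) y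
  refine DifferentiableAt.div_complex ((hD.mul_const _).sub (DifferentiableAt.mul ?_ ?_)) (hD.pow 2)
    (pow_ne_zero 2 (one_add_inner_self_ne_zero y))
  · exact DifferentiableAt.inner ℂ (differentiableAt_const _) differentiableAt_id
  · exact DifferentiableAt.inner ℂ differentiableAt_id (differentiableAt_const _)

/-- The Christoffel map of the Fubini-Study metric. -/
def fubiniStudyChristoffel (y u v : CSpace n) : CSpace n :=
  -(((1 : ℂ) + inner ℂ y y)⁻¹ • (inner ℂ y u • v + inner ℂ y v • u))

/-- Compatibility of the candidate connection with the metric. It holds for the whole Hermitian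
form, not only for its real part, because the candidate is complex bilinear. -/
theorem fderiv_fubiniStudyHermitian (y u v w : CSpace n) :
    fderiv ℝ (fun z => fubiniStudyHermitian z v w) y u =
      fubiniStudyHermitian y (fubiniStudyChristoffel y u v) w +
        fubiniStudyHermitian y v (fubiniStudyChristoffel y u w) := by
  have hD := differentiable_inner_self (n := n) y
  have hl : DifferentiableAt ℝ (fun z : CSpace n => inner ℂ v z) y :=
    DifferentiableAt.inner ℂ (differentiableAt_const _) differentiableAt_id
  have hr : DifferentiableAt ℝ (fun z : CSpace n => inner ℂ z w) y :=
    DifferentiableAt.inner ℂ differentiableAt_id (differentiableAt_const _)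
  have h0 := one_add_inner_self_ne_zero y
  have el : fderiv ℝ (fun z : CSpace n => inner ℂ v z) y u = inner ℂ v u := by
    have := fderiv_inner_apply ℂ (differentiableAt_const v) (differentiableAt_id (x := y)) u
    simpa using this
  have er : fderiv ℝ (fun z : CSpace n => inner ℂ z w) y u = inner ℂ u w := by
    have := fderiv_inner_apply ℂ (differentiableAt_id (x := y)) (differentiableAt_const w) u
    simpa using this
  have eD : fderiv ℝ (fun z : CSpace n => (1 : ℂ) + inner ℂ z z) y u = inner ℂ y u + inner ℂ u y := by
    have := fderiv_inner_apply ℂ (differentiableAt_id (x := y)) (differentiableAt_id (x := y)) u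
    rw [fderiv_const_add]
    simpa using this
  simp only [fubiniStudyHermitian]
  have eD2 : fderiv ℝ (fun z : CSpace n => ((1 : ℂ) + inner ℂ z z) ^ 2) y u =
      2 * (1 + inner ℂ y y) * (inner ℂ y u + inner ℂ u y) := by
    simp only [sq]
    rw [fderiv_mul_complex_apply hD hD, eD]
    ring
  rw [fderiv_div_complex_apply ((hD.mul_const _).fun_sub (hl.fun_mul hr)) (hD.fun_pow 2)
    (pow_ne_zero 2 h0), eD2, fderiv_fun_sub (hD.mul_const _) (hl.fun_mul hr), sub_apply,
    fderiv_mul_complex_apply hD (differentiableAt_const _), fderiv_mul_complex_apply hl hr, el, er, eD]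
  have hconj : (starRingEnd ℂ) (1 + inner ℂ y y) = 1 + inner ℂ y y := by simp
  simp only [fubiniStudyChristoffel, inner_neg_left, inner_neg_right, inner_smul_left,
    inner_smul_right, inner_add_left, inner_add_right, map_inv₀, hconj, inner_conj_symm]
  generalize hDD : (1 : ℂ) + inner ℂ y y = D at *
  have hyy : inner ℂ y y = D - 1 := by rw [← hDD]; ring
  simp
  field_simp
  ring

/-- The candidate is symmetric and compatible with the metric. In the Koszul formula these two
properties cancel all terms but h(Γ(u, v), w). -/
theorem christoffel_fubiniStudy (y u v : CSpace n) :
    christoffel fubiniStudy y u v = fubiniStudyChristoffel y u v := by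
  have hd : ∀ u v w, fderiv ℝ (fun z => fubiniStudy z v w) y u =
      fubiniStudy y (fubiniStudyChristoffel y u v) w +
        fubiniStudy y v (fubiniStudyChristoffel y u w) := fun u v w => by
    simp only [fubiniStudy_eq, ← Complex.add_re, ← fderiv_fubiniStudyHermitian]
    exact fderiv_re_apply (differentiableAt_fubiniStudyHermitian y v w) u
  have hs : ∀ u v, fubiniStudyChristoffel y u v = fubiniStudyChristoffel y v u := fun u v => by
    simp only [fubiniStudyChristoffel, add_comm]
  refine (isScalarProduct_fubiniStudy y).sharp_eq fun w => ?_
  rw [hd, hd, hd, hs v u, hs w u, hs w v,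
    (isScalarProduct_fubiniStudy y).symm v, (isScalarProduct_fubiniStudy y).symm u]
  ring

end FubiniStudy

/-! ### The projection to projective space in affine coordinates, on the unit sphere. -/

section AffineProjection

variable {E : Type*} [NormedAddCommGroup E] [NormedSpace ℝ E] {n : ℕ}

/-- The expression `z ↦ (z_j / z_i)_{j ≠ i}` in affine coordinates of the projection
`ℂ^{n+1} \ 0 → ℂP^n`. -/
def affineProj (i : Fin (n + 1)) (z : CSpace (n + 1)) : CSpace n :=
  WithLp.toLp 2 fun j => z (i.succAbove j) / z i

/-- The differential of `affineProj i` at `z`. -/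
def affineProjDeriv (i : Fin (n + 1)) (z : CSpace (n + 1)) : CSpace (n + 1) →ₗ[ℂ] CSpace n where
  toFun ζ := WithLp.toLp 2 fun j => (ζ (i.succAbove j) * z i - z (i.succAbove j) * ζ i) / z i ^ 2
  map_add' ζ η := by ext j; simp; ring
  map_smul' c ζ := by ext j; simp; ring

theorem affineProj_apply (i : Fin (n + 1)) (z : CSpace (n + 1)) (j : Fin n) :
    affineProj i z j = z (i.succAbove j) / z i := rfl

theorem affineProjDeriv_apply (i : Fin (n + 1)) (z ζ : CSpace (n + 1)) (j : Fin n) :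
    affineProjDeriv i z ζ j = (ζ (i.succAbove j) * z i - z (i.succAbove j) * ζ i) / z i ^ 2 := rfl

/-- The projection is invariant under scaling. Hence the component of a mean curvature vector along
the position vector is lost in `ℂP^n`. -/
theorem affineProjDeriv_self (i : Fin (n + 1)) (z : CSpace (n + 1)) : affineProjDeriv i z z = 0 := by
  ext j
  simp [affineProjDeriv_apply, mul_comm]

theorem differentiableAt_affineProj_comp {F : E → CSpace (n + 1)} {x : E}
    (hF : DifferentiableAt ℝ F x) {i : Fin (n + 1)} (hi : F x i ≠ 0) :
    DifferentiableAt ℝ (fun z => affineProj i (F z)) x :=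
  (differentiableAt_piLp 2).2 fun _ => DifferentiableAt.div_complex (differentiableAt_coord hF _)
    (differentiableAt_coord hF _) hi

theorem fderiv_affineProj_comp {F : E → CSpace (n + 1)} {x : E}
    (hF : DifferentiableAt ℝ F x) {i : Fin (n + 1)} (hi : F x i ≠ 0) (v : E) :
    fderiv ℝ (fun z => affineProj i (F z)) x v = affineProjDeriv i (F x) (fderiv ℝ F x v) := by
  ext j
  rw [← fderiv_apply_coord (differentiableAt_affineProj_comp hF hi)]
  simp only [affineProj_apply]
  rw [fderiv_div_complex_apply (differentiableAt_coord hF _) (differentiableAt_coord hF _) hi,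
    fderiv_apply_coord hF, fderiv_apply_coord hF, affineProjDeriv_apply]

theorem inner_eq_sum_succAbove (i : Fin (n + 1)) (z ζ : CSpace (n + 1)) :
    inner ℂ z ζ = (starRingEnd ℂ) (z i) * ζ i +
      ∑ j, (starRingEnd ℂ) (z (i.succAbove j)) * ζ (i.succAbove j) := by
  rw [PiLp.inner_apply, Fin.sum_univ_succAbove _ i]
  simp [mul_comm]

theorem one_add_inner_affineProj {i : Fin (n + 1)} {z : CSpace (n + 1)} (hi : z i ≠ 0)
    (hz : ‖z‖ = 1) :
    1 + inner ℂ (affineProj i z) (affineProj i z) = ((starRingEnd ℂ) (z i) * z i)⁻¹ := by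
  have h : inner ℂ z z = 1 := by rw [inner_self_eq_norm_sq_to_K, hz]; simp
  rw [inner_eq_sum_succAbove i] at h
  have hi' : (starRingEnd ℂ) (z i) ≠ 0 := by simpa using hi
  rw [PiLp.inner_apply]
  simp only [affineProj_apply, RCLike.inner_apply, map_div₀]
  have h2 : ∀ j, z (i.succAbove j) / z i * ((starRingEnd ℂ) (z (i.succAbove j)) / (starRingEnd ℂ) (z i)) =
      ((starRingEnd ℂ) (z i) * z i)⁻¹ * ((starRingEnd ℂ) (z (i.succAbove j)) * z (i.succAbove j)) :=
    fun j => by field_simp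
  simp only [h2, ← Finset.mul_sum]
  rw [eq_sub_of_add_eq' h]
  field_simp
  ring

theorem inner_affineProj_affineProjDeriv {i : Fin (n + 1)} {z : CSpace (n + 1)} (hi : z i ≠ 0)
    (hz : ‖z‖ = 1) (ζ : CSpace (n + 1)) :
    inner ℂ (affineProj i z) (affineProjDeriv i z ζ) =
      (inner ℂ z ζ * z i - ζ i) / ((starRingEnd ℂ) (z i) * z i ^ 2) := by
  have h : inner ℂ z z = 1 := by rw [inner_self_eq_norm_sq_to_K, hz]; simp
  rw [inner_eq_sum_succAbove i] at h
  have hi' : (starRingEnd ℂ) (z i) ≠ 0 := by simpa using hi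
  rw [inner_eq_sum_succAbove i z ζ, PiLp.inner_apply]
  simp only [affineProj_apply, affineProjDeriv_apply, RCLike.inner_apply, map_div₀]
  have h2 : ∀ j, (ζ (i.succAbove j) * z i - z (i.succAbove j) * ζ i) / z i ^ 2 *
      ((starRingEnd ℂ) (z (i.succAbove j)) / (starRingEnd ℂ) (z i)) =
      ((starRingEnd ℂ) (z i) * z i ^ 2)⁻¹ *
        ((starRingEnd ℂ) (z (i.succAbove j)) * ζ (i.succAbove j) * z i -
          ζ i * ((starRingEnd ℂ) (z (i.succAbove j)) * z (i.succAbove j))) :=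
    fun j => by field_simp
  simp only [h2, ← Finset.mul_sum, Finset.sum_sub_distrib, ← Finset.sum_mul]
  rw [eq_sub_of_add_eq' h]
  field_simp
  ring

theorem inner_affineProjDeriv {i : Fin (n + 1)} {z : CSpace (n + 1)} (hi : z i ≠ 0)
    (hz : ‖z‖ = 1) (ζ η : CSpace (n + 1)) :
    inner ℂ (affineProjDeriv i z ζ) (affineProjDeriv i z η) =
      ((starRingEnd ℂ) (z i) * z i)⁻¹ * (inner ℂ ζ η
        - (starRingEnd ℂ) (ζ i) * (inner ℂ z η) / (starRingEnd ℂ) (z i)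
        - inner ℂ ζ z * η i / z i + (starRingEnd ℂ) (ζ i) * η i / ((starRingEnd ℂ) (z i) * z i)) := by
  have h : inner ℂ z z = 1 := by rw [inner_self_eq_norm_sq_to_K, hz]; simp
  rw [inner_eq_sum_succAbove i] at h
  have hi' : (starRingEnd ℂ) (z i) ≠ 0 := by simpa using hi
  rw [inner_eq_sum_succAbove i z η, inner_eq_sum_succAbove i ζ η, inner_eq_sum_succAbove i ζ z,
    PiLp.inner_apply]
  simp only [affineProjDeriv_apply, RCLike.inner_apply, map_div₀, map_sub, map_mul, map_pow]
  have h2 : ∀ j, (η (i.succAbove j) * z i - z (i.succAbove j) * η i) / z i ^ 2 *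
      (((starRingEnd ℂ) (ζ (i.succAbove j)) * (starRingEnd ℂ) (z i) -
        (starRingEnd ℂ) (z (i.succAbove j)) * (starRingEnd ℂ) (ζ i)) / (starRingEnd ℂ) (z i) ^ 2) =
      ((starRingEnd ℂ) (z i) * z i)⁻¹ * ((starRingEnd ℂ) (ζ (i.succAbove j)) * η (i.succAbove j)
        - ((starRingEnd ℂ) (ζ i) / (starRingEnd ℂ) (z i)) *
          ((starRingEnd ℂ) (z (i.succAbove j)) * η (i.succAbove j))
        - (η i / z i) * ((starRingEnd ℂ) (ζ (i.succAbove j)) * z (i.succAbove j))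
        + ((starRingEnd ℂ) (ζ i) / (starRingEnd ℂ) (z i)) * (η i / z i) *
          ((starRingEnd ℂ) (z (i.succAbove j)) * z (i.succAbove j))) :=
    fun j => by field_simp; ring
  simp only [h2, ← Finset.mul_sum, Finset.sum_sub_distrib, Finset.sum_add_distrib]
  rw [eq_sub_of_add_eq' h]
  field_simp
  ring

/-- The Hopf fibration is a Riemannian submersion: the right side is the Hermitian product of the
components orthogonal to `z`. If one of the two vectors is orthogonal to `z`, it is simply the
product in ℂ^{n+1}. -/
theorem fubiniStudyHermitian_affineProjDeriv {i : Fin (n + 1)} {z : CSpace (n + 1)} (hi : z i ≠ 0)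
    (hz : ‖z‖ = 1) (ζ η : CSpace (n + 1)) :
    fubiniStudyHermitian (affineProj i z) (affineProjDeriv i z ζ) (affineProjDeriv i z η) =
      inner ℂ ζ η - inner ℂ ζ z * inner ℂ z η := by
  have hi' : (starRingEnd ℂ) (z i) ≠ 0 := by simpa using hi
  rw [fubiniStudyHermitian, one_add_inner_affineProj hi hz, inner_affineProjDeriv hi hz,
    ← inner_conj_symm (affineProjDeriv i z ζ), inner_affineProj_affineProjDeriv hi hz,
    inner_affineProj_affineProjDeriv hi hz]
  simp only [map_div₀, map_sub, map_mul, map_pow, inner_conj_symm, Complex.conj_conj]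
  field_simp
  ring

end AffineProjection

/-! ### Differentiability of determinants and inverse matrices. -/

section MatrixCalculus

variable {E : Type*} [NormedAddCommGroup E] [NormedSpace ℝ E] {ι : Type*} [Fintype ι] [DecidableEq ι]

theorem differentiableAt_det {M : E → Matrix ι ι ℝ} {x : E}
    (h : ∀ i j, DifferentiableAt ℝ (fun z => M z i j) x) :
    DifferentiableAt ℝ (fun z => (M z).det) x := by
  simp only [Matrix.det_apply']
  exact DifferentiableAt.fun_sum fun σ _ =>
    DifferentiableAt.const_mul (by fun_prop) _

theorem differentiableAt_inv_apply {M : E → Matrix ι ι ℝ} {x : E}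
    (h : ∀ i j, DifferentiableAt ℝ (fun z => M z i j) x) (h0 : (M x).det ≠ 0) (i j : ι) :
    DifferentiableAt ℝ (fun z => (M z)⁻¹ i j) x := by
  simp only [Matrix.inv_def, Ring.inverse_eq_inv', Matrix.smul_apply, smul_eq_mul,
    Matrix.adjugate_apply]
  refine ((differentiableAt_det h).inv h0).mul (differentiableAt_det fun k l => ?_)
  -- An entry of the adjugate is the determinant of the matrix with row `j` replaced by a constant
  -- vector.
  by_cases hk : k = j
  · subst hk
    simp
  · simpa [hk] using h k l

end MatrixCalculus

/-! ### Legendrian immersions in the sphere, the cubic form and the mean form. -/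

section Legendrian

variable {E : Type*} [NormedAddCommGroup E] [NormedSpace ℝ E] [FiniteDimensional ℝ E] {m : ℕ}

theorem christoffel_euclidean (y u v : CSpace m) : christoffel euclidean y u v = 0 := by
  simp [christoffel, euclidean, sharp]

theorem map_metricTrace {F : Type*} [NormedAddCommGroup F] [NormedSpace ℝ F] {F' : Type*}
    [NormedAddCommGroup F'] [NormedSpace ℝ F'] (l : F →ₗ[ℝ] F') (g : E → E → ℝ) (B : E → E → F) :
    l (metricTrace g B) = metricTrace g fun u v => l (B u v) := by
  simp [metricTrace]

/-- The linear form `Re ⟨ξ, ·⟩`. -/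
def reInner (ξ : CSpace m) : CSpace m →ₗ[ℝ] ℝ :=
  Complex.reLm ∘ₗ ((innerSL ℂ ξ : CSpace m →L[ℂ] ℂ) : CSpace m →ₗ[ℂ] ℂ).restrictScalars ℝ

/-- The linear form `Im ⟨ξ, ·⟩`. -/
def imInner (ξ : CSpace m) : CSpace m →ₗ[ℝ] ℝ :=
  Complex.imLm ∘ₗ ((innerSL ℂ ξ : CSpace m →L[ℂ] ℂ) : CSpace m →ₗ[ℂ] ℂ).restrictScalars ℝ

theorem reInner_apply (ξ η : CSpace m) : reInner ξ η = (inner ℂ ξ η).re := rfl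

theorem imInner_apply (ξ η : CSpace m) : imInner ξ η = (inner ℂ ξ η).im := rfl

theorem inner_real_smul_left (c : ℝ) (ξ η : CSpace m) :
    inner ℂ (c • ξ) η = (c : ℂ) * inner ℂ ξ η := by
  rw [← Complex.coe_smul c ξ, inner_smul_left, Complex.conj_ofReal]

theorem inner_real_smul_right (c : ℝ) (ξ η : CSpace m) :
    inner ℂ ξ (c • η) = (c : ℂ) * inner ℂ ξ η := by
  rw [← Complex.coe_smul c η, inner_smul_right]

theorem re_inner_I_smul_left (ξ η : CSpace m) :
    (inner ℂ (Complex.I • ξ) η).re = (inner ℂ ξ η).im := by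
  rw [inner_smul_left]
  simp

/-- The second derivative `D²f(u, v)`. -/
def secondDeriv (f : E → CSpace m) (x u v : E) : CSpace m :=
  fderiv ℝ (fun z => fderiv ℝ f z v) x u

/-- The cubic form `⟨σ(u, v), J f_* w⟩` of a Legendrian immersion `f` in the sphere, up to sign. -/
def cubicForm (f : E → CSpace m) (x u v w : E) : ℝ :=
  (inner ℂ (secondDeriv f x u v) (fderiv ℝ f x w)).im

/-- The mean curvature form `⟨J H, f_* w⟩`. -/
def meanForm (f : E → CSpace m) (x : E) : E →ₗ[ℝ] ℝ :=
  imInner (meanCurvature euclidean f x) ∘ₗ (fderiv ℝ f x : E →ₗ[ℝ] CSpace m)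

theorem meanForm_apply (f : E → CSpace m) (x w : E) :
    meanForm f x w = (inner ℂ (meanCurvature euclidean f x) (fderiv ℝ f x w)).im := rfl

/-- `f` is a smooth immersion of the open set `U` in the unit sphere, whose differential is
orthogonal to the vector `i f`. -/
structure LegendrianOn (f : E → CSpace m) (U : Set E) : Prop where
  isOpen : IsOpen U
  contDiffOn : ContDiffOn ℝ ∞ f U
  norm_eq_one : ∀ x ∈ U, ‖f x‖ = 1
  injective : ∀ x ∈ U, Function.Injective (fderiv ℝ f x)
  inner_fderiv : ∀ x ∈ U, ∀ v, inner ℂ (f x) (fderiv ℝ f x v) = 0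

namespace LegendrianOn

variable {f : E → CSpace m} {U : Set E} (hf : LegendrianOn f U) {x : E} (hx : x ∈ U)
include hf hx

theorem mem_nhds : U ∈ 𝓝 x := hf.isOpen.mem_nhds hx

theorem contDiffAt : ContDiffAt ℝ ∞ f x := hf.contDiffOn.contDiffAt (hf.mem_nhds hx)

theorem differentiableAt : DifferentiableAt ℝ f x := (hf.contDiffAt hx).differentiableAt (by simp)

theorem contDiffAt_fderiv (v : E) : ContDiffAt ℝ ∞ (fun z => fderiv ℝ f z v) x :=
  ((hf.contDiffAt hx).fderiv_right (m := ∞) (by simp)).clm_apply contDiffAt_const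

theorem differentiableAt_fderiv (v : E) : DifferentiableAt ℝ (fun z => fderiv ℝ f z v) x :=
  (hf.contDiffAt_fderiv hx v).differentiableAt (by simp)

theorem differentiableAt_secondDeriv (u v : E) :
    DifferentiableAt ℝ (fun z => secondDeriv f z u v) x :=
  (((hf.contDiffAt_fderiv hx v).fderiv_right (m := ∞) (by simp)).clm_apply
    contDiffAt_const).differentiableAt (by simp)

theorem secondDeriv_eq (u v : E) : secondDeriv f x u v = fderiv ℝ (fderiv ℝ f) x u v := by
  have hd : DifferentiableAt ℝ (fderiv ℝ f) x :=
    ((hf.contDiffAt hx).fderiv_right (m := ∞) (by simp)).differentiableAt (by simp)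
  have h := fderiv_clm_apply hd (differentiableAt_const v)
  rw [secondDeriv, h]
  simp

theorem secondDeriv_comm (u v : E) : secondDeriv f x u v = secondDeriv f x v u := by
  rw [hf.secondDeriv_eq hx, hf.secondDeriv_eq hx]
  exact (hf.contDiffAt hx).isSymmSndFDerivAt
    (by rw [minSmoothness_of_isRCLikeNormedField]; exact ENat.LEInfty.out) u v

theorem inner_self : inner ℂ (f x) (f x) = 1 := by
  rw [inner_self_eq_norm_sq_to_K, hf.norm_eq_one x hx]
  simp

theorem inner_fderiv_left (v : E) : inner ℂ (fderiv ℝ f x v) (f x) = 0 := by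
  rw [← inner_conj_symm, hf.inner_fderiv x hx, map_zero]

/-- Derivative in the direction `u` of the identity ⟨f, f_*v⟩ = 0. -/
theorem inner_secondDeriv (u v : E) :
    inner ℂ (f x) (secondDeriv f x u v) = -inner ℂ (fderiv ℝ f x u) (fderiv ℝ f x v) := by
  have h1 : (fun z => inner ℂ (f z) (fderiv ℝ f z v)) =ᶠ[𝓝 x] fun _ => 0 := by
    filter_upwards [hf.mem_nhds hx] with z hz using hf.inner_fderiv z hz v
  have h2 := fderiv_inner_apply ℂ (hf.differentiableAt hx) (hf.differentiableAt_fderiv hx v) u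
  rw [h1.fderiv_eq] at h2
  simp only [fderiv_fun_const, Pi.zero_apply, zero_apply] at h2
  exact eq_neg_of_add_eq_zero_left h2.symm

/-- By `inner_secondDeriv` and the symmetry of second derivatives, ⟨f_*u, f_*v⟩ is symmetric. Being
also Hermitian, it is real. This is the Lagrangian condition downstairs. -/
theorem inner_fderiv_fderiv (u v : E) : inner ℂ (fderiv ℝ f x u) (fderiv ℝ f x v) =
    (inducedMetric euclidean f x u v : ℂ) := by
  have h1 : inner ℂ (fderiv ℝ f x u) (fderiv ℝ f x v) = inner ℂ (fderiv ℝ f x v) (fderiv ℝ f x u) := by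
    rw [← neg_inj, ← hf.inner_secondDeriv hx, ← hf.inner_secondDeriv hx, hf.secondDeriv_comm hx]
  rw [← inner_conj_symm (fderiv ℝ f x v), eq_comm] at h1
  exact Complex.ext rfl ((Complex.conj_eq_iff_im.1 h1).trans (Complex.ofReal_im _).symm)

theorem isScalarProduct : IsScalarProduct (inducedMetric euclidean f x) where
  add_left u u' v := by simp [inducedMetric, euclidean]
  smul_left c u v := by simp [inducedMetric, euclidean]
  symm u v := by rw [inducedMetric, euclidean, ← inner_conj_symm, Complex.conj_re]; rfl
  pos u hu := by
    have h : fderiv ℝ f x u ≠ 0 := fun h => hu (hf.injective x hx (h.trans (map_zero _).symm))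
    rw [inducedMetric, euclidean, inner_self_eq_norm_sq_to_K]
    have : 0 < ‖fderiv ℝ f x u‖ ^ 2 := by positivity
    exact_mod_cast this

theorem re_inner_normalPart (ξ : CSpace m) (w : E) :
    (inner ℂ (normalPart (euclidean (f x)) (fderiv ℝ f x) ξ) (fderiv ℝ f x w)).re = 0 := by
  have h := (hf.isScalarProduct hx).apply_sharp (reInner ξ ∘ₗ (fderiv ℝ f x : E →ₗ[ℝ] CSpace m)) w
  rw [normalPart, inner_sub_left, Complex.sub_re, sub_eq_zero]
  exact h.symm

/-- The tangential part of `ξ` has real products with tangent vectors, so the imaginary part does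
not see it. This is why the cubic form may be defined with D²f in place of the second fundamental
form. -/
theorem im_inner_normalPart (ξ : CSpace m) (w : E) :
    (inner ℂ (normalPart (euclidean (f x)) (fderiv ℝ f x) ξ) (fderiv ℝ f x w)).im =
      (inner ℂ ξ (fderiv ℝ f x w)).im := by
  rw [normalPart, inner_sub_left, hf.inner_fderiv_fderiv hx]
  simp

theorem secondFundamentalForm_euclidean (u v : E) : secondFundamentalForm euclidean f x u v =
    normalPart (euclidean (f x)) (fderiv ℝ f x) (secondDeriv f x u v) := by
  rw [secondFundamentalForm, christoffel_euclidean, add_zero]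
  rfl

omit hf hx in
theorem finrank_smul_meanCurvature {F : Type*} [NormedAddCommGroup F] [NormedSpace ℝ F]
    [FiniteDimensional ℝ F] (h : F → F → F → ℝ) (f : E → F) (x : E) :
    (finrank ℝ E : ℝ) • meanCurvature h f x =
      metricTrace (inducedMetric h f x) (secondFundamentalForm h f x) := by
  rw [meanCurvature]
  -- In dimension 0 the trace is an empty sum, so both sides vanish although the factor cannot be
  -- inverted.
  rcases eq_or_ne (finrank ℝ E) 0 with h0 | h0
  · have : IsEmpty (Fin (finrank ℝ E)) := by rw [h0]; infer_instance
    simp [metricTrace]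
  · rw [smul_inv_smul₀ (by exact_mod_cast h0)]

theorem finrank_mul_meanForm (w : E) :
    finrank ℝ E * meanForm f x w =
      metricTrace (inducedMetric euclidean f x) fun u v => cubicForm f x u v w := by
  have h1 : ∀ ξ, -imInner (fderiv ℝ f x w) ξ = (inner ℂ ξ (fderiv ℝ f x w)).im := fun ξ => by
    rw [imInner_apply, ← inner_conj_symm, Complex.conj_im, neg_neg]
  have h2 := congrArg (-imInner (fderiv ℝ f x w)) (finrank_smul_meanCurvature euclidean f x)
  rw [map_metricTrace, map_smul, smul_eq_mul] at h2
  simp only [LinearMap.neg_apply, h1, hf.secondFundamentalForm_euclidean hx,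
    hf.im_inner_normalPart hx] at h2
  exact h2

theorem re_inner_meanCurvature (w : E) :
    (inner ℂ (meanCurvature euclidean f x) (fderiv ℝ f x w)).re = 0 := by
  have h1 : ∀ ξ, reInner (fderiv ℝ f x w) ξ = (inner ℂ ξ (fderiv ℝ f x w)).re := fun ξ => by
    rw [reInner_apply, ← inner_conj_symm, Complex.conj_re]
  rw [← h1, meanCurvature, map_smul, map_metricTrace]
  simp [h1, hf.secondFundamentalForm_euclidean hx, hf.re_inner_normalPart hx, metricTrace]

theorem im_inner_self_meanCurvature : (inner ℂ (f x) (meanCurvature euclidean f x)).im = 0 := by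
  rw [← imInner_apply, meanCurvature, map_smul, map_metricTrace]
  simp [imInner_apply, hf.secondFundamentalForm_euclidean hx, normalPart,
    hf.inner_fderiv x hx, hf.inner_secondDeriv hx, hf.inner_fderiv_fderiv hx, metricTrace]

theorem inner_self_meanCurvature : inner ℂ (f x) (meanCurvature euclidean f x) =
    (euclidean (f x) (meanCurvature euclidean f x) (f x) : ℂ) := by
  refine Complex.ext ?_ ?_
  · rw [euclidean, ← inner_conj_symm, Complex.conj_re, Complex.ofReal_re]
  · rw [hf.im_inner_self_meanCurvature hx, Complex.ofReal_im]

/-- The tangent space, its multiple by i and the complex line of f(x) are independent, because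
products of tangent vectors are real and f(x) is orthogonal to them. Their real dimensions add up to
2 dim E + 2 = 2m, so together they span ℂ^m. -/
theorem eq_zero_of_orthogonal (hm : finrank ℝ E + 1 = m) {ξ : CSpace m} (h0 : inner ℂ ξ (f x) = 0)
    (h1 : ∀ v, inner ℂ ξ (fderiv ℝ f x v) = 0) : ξ = 0 := by
  let A : E →ₗ[ℝ] CSpace m := fderiv ℝ f x
  let T : E × E × ℂ →ₗ[ℝ] CSpace m :=
    A.coprod (LinearMap.coprod ((LinearMap.lsmul ℂ (CSpace m) Complex.I).restrictScalars ℝ ∘ₗ A)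
      ((LinearMap.toSpanSingleton ℂ (CSpace m) (f x)).restrictScalars ℝ))
  have hT : ∀ u v c, T (u, v, c) = fderiv ℝ f x u + (Complex.I • fderiv ℝ f x v + c • f x) :=
    fun u v c => rfl
  have hinj : Function.Injective T := by
    rw [← LinearMap.ker_eq_bot, LinearMap.ker_eq_bot']
    rintro ⟨u, v, c⟩ h
    rw [hT] at h
    have e0 := congrArg (inner ℂ (f x)) h
    simp only [inner_add_right, inner_smul_right, hf.inner_fderiv x hx, hf.inner_self hx,
      inner_zero_right, mul_zero, mul_one, zero_add] at e0
    have e1 : ∀ w, inducedMetric euclidean f x w u = 0 ∧ inducedMetric euclidean f x w v = 0 :=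
      fun w => by
        have e := congrArg (inner ℂ (fderiv ℝ f x w)) h
        simp only [inner_add_right, inner_smul_right, hf.inner_fderiv_fderiv hx,
          hf.inner_fderiv_left hx, inner_zero_right, mul_zero, add_zero] at e
        have er := congrArg Complex.re e
        have ei := congrArg Complex.im e
        simp at er ei
        exact ⟨er, ei⟩
    have hu : u = 0 := by
      by_contra hu
      exact ((hf.isScalarProduct hx).pos u hu).ne' (e1 u).1
    have hv : v = 0 := by
      by_contra hv
      exact ((hf.isScalarProduct hx).pos v hv).ne' (e1 v).2
    rw [hu, hv, e0]
    rfl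
  have hdim : finrank ℝ (E × E × ℂ) = finrank ℝ (CSpace m) := by
    rw [finrank_prod, finrank_prod, Complex.finrank_real_complex, ← finrank_mul_finrank ℝ ℂ (CSpace m),
      Complex.finrank_real_complex, finrank_euclideanSpace_fin]
    omega
  obtain ⟨⟨u, v, c⟩, h⟩ := (LinearMap.injective_iff_surjective_of_finrank_eq_finrank hdim).1 hinj ξ
  rw [hT] at h
  have h2 := congrArg (inner ℂ ξ) h
  rw [← inner_self_eq_zero (𝕜 := ℂ), ← h2]
  simp [h0, h1]

-- The mean curvature vectors in the sphere and in Euclidean space differ by a multiple of `f`,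
-- which is Hermitian-orthogonal to the tangent vectors.
omit hf in
theorem sphereJH_eq_sharp {f : E → CSpace (m + 1)} (hf : LegendrianOn f U) :
    sphereJH f x = sharp (inducedMetric euclidean f x) (meanForm f x) := by
  change sharp (inducedMetric euclidean f x) (fun v => euclidean (f x)
    (Complex.I • sphereMeanCurvature f x) (fderiv ℝ f x v)) = _
  congr 1
  funext v
  rw [euclidean, re_inner_I_smul_left, sphereMeanCurvature, inner_sub_left, inner_real_smul_left,
    hf.inner_fderiv x hx, mul_zero, sub_zero, meanForm_apply]

-- The mean curvature vector in the sphere is Hermitian-orthogonal to `f`, and its products with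
-- tangent vectors have no real part. The remaining imaginary parts are the values of the mean form,
-- and `eq_zero_of_orthogonal` applies.
omit hf in
theorem sphereMeanCurvature_eq_zero_iff (hm : finrank ℝ E = m) {f : E → CSpace (m + 1)}
    (hf : LegendrianOn f U) : sphereMeanCurvature f x = 0 ↔ meanForm f x = 0 := by
  constructor
  · intro h
    ext v
    rw [sphereMeanCurvature, sub_eq_zero] at h
    rw [meanForm_apply, h, inner_real_smul_left, hf.inner_fderiv x hx]
    simp
  · intro h
    refine hf.eq_zero_of_orthogonal hx (by rw [hm]) ?_ fun v => ?_
    · rw [sphereMeanCurvature, ← inner_conj_symm, inner_sub_right, inner_real_smul_right,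
        hf.inner_self hx, hf.inner_self_meanCurvature hx]
      simp
    · rw [sphereMeanCurvature, inner_sub_left, inner_real_smul_left, hf.inner_fderiv x hx, mul_zero,
        sub_zero]
      exact Complex.ext (hf.re_inner_meanCurvature hx v) (LinearMap.congr_fun h v)

theorem differentiableAt_gram (i j : Fin (finrank ℝ E)) :
    DifferentiableAt ℝ (fun z => gram (inducedMetric euclidean f z) i j) x :=
  Complex.reCLM.differentiableAt.comp x
    (DifferentiableAt.inner ℂ (hf.differentiableAt_fderiv hx _) (hf.differentiableAt_fderiv hx _))

theorem differentiableAt_sqrt_det_gram :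
    DifferentiableAt ℝ (fun z => √(gram (inducedMetric euclidean f z)).det) x :=
  (differentiableAt_det (hf.differentiableAt_gram hx)).sqrt (hf.isScalarProduct hx).det_gram_pos.ne'

theorem differentiableAt_cubicForm (u v w : E) : DifferentiableAt ℝ (fun z => cubicForm f z u v w) x :=
  Complex.imCLM.differentiableAt.comp x
    (DifferentiableAt.inner ℂ (hf.differentiableAt_secondDeriv hx u v) (hf.differentiableAt_fderiv hx w))

theorem meanForm_eq (w : E) : meanForm f x w = (finrank ℝ E : ℝ)⁻¹ *
    metricTrace (inducedMetric euclidean f x) fun u v => cubicForm f x u v w := by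
  rw [← hf.finrank_mul_meanForm hx]
  rcases eq_or_ne (finrank ℝ E) 0 with h0 | h0
  · have := finrank_zero_iff.1 h0
    rw [Subsingleton.elim w 0, map_zero]
    simp
  · rw [inv_mul_cancel_left₀ (by exact_mod_cast h0)]

-- On `U` the field is a polynomial in the entries of the inverse Gram matrix and the values of the
-- cubic form on basis vectors, all of which are differentiable.
omit hf in
theorem differentiableAt_sphereJH {f : E → CSpace (m + 1)} (hf : LegendrianOn f U) :
    DifferentiableAt ℝ (sphereJH f) x := by
  have hd := (hf.isScalarProduct hx).det_gram_pos.ne'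
  have hi := differentiableAt_inv_apply (hf.differentiableAt_gram hx) hd
  have hm : ∀ w, DifferentiableAt ℝ (fun z => meanForm f z w) x := fun w => by
    have h : (fun z => meanForm f z w) =ᶠ[𝓝 x] fun z => (finrank ℝ E : ℝ)⁻¹ *
        metricTrace (inducedMetric euclidean f z) fun u v => cubicForm f z u v w := by
      filter_upwards [hf.mem_nhds hx] with z hz using hf.meanForm_eq hz w
    refine DifferentiableAt.congr_of_eventuallyEq ?_ h
    exact (DifferentiableAt.fun_sum fun i _ => DifferentiableAt.fun_sum fun j _ =>
      (hi i j).smul (hf.differentiableAt_cubicForm hx _ _ w)).const_mul _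
  have h : sphereJH f =ᶠ[𝓝 x] fun z => sharp (inducedMetric euclidean f z) (meanForm f z) := by
    filter_upwards [hf.mem_nhds hx] with z hz using hf.sphereJH_eq_sharp hz
  refine DifferentiableAt.congr_of_eventuallyEq ?_ h
  exact DifferentiableAt.fun_sum fun i _ => DifferentiableAt.fun_sum fun j _ =>
    ((hi i j).mul (hm _)).smul_const _

end LegendrianOn

end Legendrian

/-! ### Geometry of the projection of a Legendrian immersion to projective space. -/

section Projection

variable {E : Type*} [NormedAddCommGroup E] [NormedSpace ℝ E] [FiniteDimensional ℝ E] {n : ℕ}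

theorem fderiv_affineProjDeriv_apply {F ζ : E → CSpace (n + 1)} {x : E}
    (hF : DifferentiableAt ℝ F x) (hζ : DifferentiableAt ℝ ζ x) {i : Fin (n + 1)} (hi : F x i ≠ 0)
    (u : E) :
    fderiv ℝ (fun z => affineProjDeriv i (F z) (ζ z)) x u =
      affineProjDeriv i (F x) (fderiv ℝ ζ x u)
        - (fderiv ℝ F x u i / F x i) • affineProjDeriv i (F x) (ζ x)
        - (ζ x i / F x i) • affineProjDeriv i (F x) (fderiv ℝ F x u) := by
  have c₁ := differentiableAt_coord hF
  have c₂ := differentiableAt_coord hζ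
  have d₁ : ∀ j, DifferentiableAt ℝ
      (fun z => ζ z (i.succAbove j) * F z i - F z (i.succAbove j) * ζ z i) x :=
    fun j => ((c₂ _).fun_mul (c₁ i)).fun_sub ((c₁ _).fun_mul (c₂ i))
  have d₂ : DifferentiableAt ℝ (fun z => F z i ^ 2) x := (c₁ i).fun_pow 2
  have h2 : F x i ^ 2 ≠ 0 := pow_ne_zero 2 hi
  have hd : DifferentiableAt ℝ (fun z => affineProjDeriv i (F z) (ζ z)) x :=
    (differentiableAt_piLp 2).2 fun j => DifferentiableAt.div_complex (d₁ j) d₂ h2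
  have e₂ : fderiv ℝ (fun z => F z i ^ 2) x u = 2 * F x i * fderiv ℝ F x u i := by
    simp only [sq]
    rw [fderiv_mul_complex_apply (c₁ i) (c₁ i), fderiv_apply_coord hF]
    ring
  ext j
  rw [← fderiv_apply_coord hd]
  simp only [affineProjDeriv_apply, PiLp.sub_apply, PiLp.smul_apply, smul_eq_mul]
  rw [fderiv_div_complex_apply (d₁ j) d₂ h2, e₂,
    fderiv_fun_sub ((c₂ _).fun_mul (c₁ i)) ((c₁ _).fun_mul (c₂ i)), sub_apply,
    fderiv_mul_complex_apply (c₂ _) (c₁ i), fderiv_mul_complex_apply (c₁ _) (c₂ i),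
    fderiv_apply_coord hF, fderiv_apply_coord hF, fderiv_apply_coord hζ, fderiv_apply_coord hζ]
  field_simp
  ring

theorem fubiniStudy_I_smul (y u v : CSpace n) :
    fubiniStudy y (Complex.I • u) v = (fubiniStudyHermitian y u v).im := by
  rw [fubiniStudy_eq, fubiniStudyHermitian_smul_left]
  simp

namespace LegendrianOn

variable {F : E → CSpace (n + 1)} {U : Set E} (hF : LegendrianOn F U) {i : Fin (n + 1)}
  (hi : ∀ x ∈ U, F x i ≠ 0) {x : E} (hx : x ∈ U)
include hF hi hx

theorem fderiv_proj (v : E) :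
    fderiv ℝ (fun z => affineProj i (F z)) x v = affineProjDeriv i (F x) (fderiv ℝ F x v) :=
  fderiv_affineProj_comp (hF.differentiableAt hx) (hi x hx) v

theorem fubiniStudyHermitian_fderiv (ξ : CSpace (n + 1)) (v : E) :
    fubiniStudyHermitian (affineProj i (F x)) (affineProjDeriv i (F x) ξ)
      (fderiv ℝ (fun z => affineProj i (F z)) x v) = inner ℂ ξ (fderiv ℝ F x v) := by
  rw [hF.fderiv_proj hi hx, fubiniStudyHermitian_affineProjDeriv (hi x hx) (hF.norm_eq_one x hx),
    hF.inner_fderiv x hx, mul_zero, sub_zero]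

theorem inducedMetric_fubiniStudy :
    inducedMetric fubiniStudy (fun z => affineProj i (F z)) x = inducedMetric euclidean F x := by
  funext u v
  rw [inducedMetric, hF.fderiv_proj hi hx u, fubiniStudy_eq, hF.fubiniStudyHermitian_fderiv hi hx]
  rfl

theorem tangentPart_fubiniStudy (ξ : CSpace (n + 1)) :
    tangentPart (fubiniStudy (affineProj i (F x))) (fderiv ℝ (fun z => affineProj i (F z)) x)
      (affineProjDeriv i (F x) ξ) = tangentPart (euclidean (F x)) (fderiv ℝ F x) ξ := by
  have h := hF.inducedMetric_fubiniStudy hi hx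
  refine (congrArg (fun g => sharp g _) h).trans ?_
  refine congrArg (sharp (inducedMetric euclidean F x)) (funext fun v => ?_)
  rw [fubiniStudy_eq, hF.fubiniStudyHermitian_fderiv hi hx]
  rfl

/-- The Levi-Civita derivative of the projected immersion is the projection of D²F, and taking
normal parts commutes with the projection. -/
theorem secondFundamentalForm_fubiniStudy (u v : E) :
    secondFundamentalForm fubiniStudy (fun z => affineProj i (F z)) x u v =
      affineProjDeriv i (F x) (secondFundamentalForm euclidean F x u v) := by
  have hz := hF.norm_eq_one x hx
  have h0 := hi x hx
  have h0' : (starRingEnd ℂ) (F x i) ≠ 0 := by simpa using h0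
  have h1 : (fun z => fderiv ℝ (fun z => affineProj i (F z)) z v) =ᶠ[𝓝 x]
      fun z => affineProjDeriv i (F z) (fderiv ℝ F z v) := by
    filter_upwards [hF.mem_nhds hx] with z hz using hF.fderiv_proj hi hz v
  -- Differentiating the projection leaves two correction terms with factors (F_*u)_i / F_i and
  -- (F_*v)_i / F_i. Since F_*u and F_*v are orthogonal to F, the Christoffel term equals exactly
  -- their negatives.
  have h2 : fderiv ℝ (fun z => fderiv ℝ (fun z => affineProj i (F z)) z v) x u +
      christoffel fubiniStudy (affineProj i (F x)) (fderiv ℝ (fun z => affineProj i (F z)) x u)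
        (fderiv ℝ (fun z => affineProj i (F z)) x v) =
      affineProjDeriv i (F x) (secondDeriv F x u v) := by
    rw [h1.fderiv_eq, fderiv_affineProjDeriv_apply (hF.differentiableAt hx)
      (hF.differentiableAt_fderiv hx v) h0, christoffel_fubiniStudy, fubiniStudyChristoffel,
      hF.fderiv_proj hi hx, hF.fderiv_proj hi hx, inner_affineProj_affineProjDeriv h0 hz,
      inner_affineProj_affineProjDeriv h0 hz, hF.inner_fderiv x hx, hF.inner_fderiv x hx,
      one_add_inner_affineProj h0 hz, inv_inv, smul_add, smul_smul, smul_smul]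
    have h3 : ∀ c : ℂ, (starRingEnd ℂ) (F x i) * F x i *
        ((0 * F x i - c) / ((starRingEnd ℂ) (F x i) * F x i ^ 2)) = -(c / F x i) := fun c => by
      field_simp
      ring
    rw [h3, h3, neg_smul, neg_smul]
    change affineProjDeriv i (F x) (secondDeriv F x u v) - _ - _ + _ = _
    abel
  rw [secondFundamentalForm, h2, hF.secondFundamentalForm_euclidean hx, normalPart, normalPart,
    hF.tangentPart_fubiniStudy hi hx, hF.fderiv_proj hi hx, map_sub]

theorem meanCurvature_fubiniStudy :
    meanCurvature fubiniStudy (fun z => affineProj i (F z)) x =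
      affineProjDeriv i (F x) (meanCurvature euclidean F x) := by
  have h := map_metricTrace ((affineProjDeriv i (F x)).restrictScalars ℝ)
    (inducedMetric euclidean F x) (secondFundamentalForm euclidean F x)
  have h' : secondFundamentalForm fubiniStudy (fun z => affineProj i (F z)) x =
      fun u v => affineProjDeriv i (F x) (secondFundamentalForm euclidean F x u v) :=
    funext fun u => funext fun v => hF.secondFundamentalForm_fubiniStudy hi hx u v
  rw [meanCurvature, meanCurvature, hF.inducedMetric_fubiniStudy hi hx, h']
  refine Eq.trans ?_ (map_smul ((affineProjDeriv i (F x)).restrictScalars ℝ) _ _).symm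
  rw [h]
  rfl

theorem projJH_eq_sharp : projJH (fun z => affineProj i (F z)) x =
    sharp (inducedMetric euclidean F x) (meanForm F x) := by
  rw [projJH, hF.meanCurvature_fubiniStudy hi hx, ← map_smul, hF.tangentPart_fubiniStudy hi hx]
  exact congrArg (sharp (inducedMetric euclidean F x)) (funext fun v => re_inner_I_smul_left _ _)

/-- If the mean form vanishes, the Euclidean mean curvature vector of the lift is a multiple of `F`,
and the projection kills it. Conversely the projection preserves products with tangent vectors. -/
theorem meanCurvature_fubiniStudy_eq_zero_iff (hm : finrank ℝ E = n) :
    meanCurvature fubiniStudy (fun z => affineProj i (F z)) x = 0 ↔ meanForm F x = 0 := by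
  rw [hF.meanCurvature_fubiniStudy hi hx]
  constructor
  · intro h
    ext v
    rw [meanForm_apply, ← hF.fubiniStudyHermitian_fderiv hi hx, h]
    simp [fubiniStudyHermitian]
  · intro h
    have h1 := (hF.sphereMeanCurvature_eq_zero_iff hx hm).2 h
    rw [sphereMeanCurvature, sub_eq_zero] at h1
    rw [h1, ← Complex.coe_smul, map_smul, affineProjDeriv_self, smul_zero]

theorem injective_fderiv_proj :
    Function.Injective (fderiv ℝ (fun z => affineProj i (F z)) x) := by
  rw [injective_iff_map_eq_zero]
  intro v hv
  by_contra hne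
  have h := (hF.isScalarProduct hx).pos v hne
  rw [← hF.inducedMetric_fubiniStudy hi hx, inducedMetric, hv, fubiniStudy_eq] at h
  simp [fubiniStudyHermitian] at h

theorem fubiniStudyForm_fderiv_proj (u v : E) :
    fubiniStudyForm (affineProj i (F x)) (fderiv ℝ (fun z => affineProj i (F z)) x u)
      (fderiv ℝ (fun z => affineProj i (F z)) x v) = 0 := by
  rw [fubiniStudyForm, fubiniStudy_I_smul, hF.fderiv_proj hi hx u,
    hF.fubiniStudyHermitian_fderiv hi hx, hF.inner_fderiv_fderiv hx, Complex.ofReal_im]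

theorem contDiffAt_proj : ContDiffAt ℝ ∞ (fun z => affineProj i (F z)) x := by
  refine (contDiffAt_piLp 2).2 fun j => ?_
  have hc : ∀ k, ContDiffAt ℝ ∞ (fun z => F z k) x :=
    fun k => (contDiffAt_piLp 2).1 (hF.contDiffAt hx) k
  simp only [affineProj_apply, div_eq_mul_inv]
  exact (hc _).mul ((hc i).inv (hi x hx))

end LegendrianOn

end Projection

/-! ### Algebra of metric traces. -/

section MetricTraceLemmas

variable {E : Type*} [NormedAddCommGroup E] [NormedSpace ℝ E] [FiniteDimensional ℝ E]

theorem metricTrace_add (g : E → E → ℝ) (B B' : E → E → ℝ) :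
    metricTrace g (fun u v => B u v + B' u v) = metricTrace g B + metricTrace g B' := by
  simp [metricTrace, mul_add, Finset.sum_add_distrib]

theorem IsScalarProduct.metricTrace_mul_self {g : E → E → ℝ} (hg : IsScalarProduct g) (c : ℝ) :
    metricTrace g (fun u v => c * g u v) = c * finrank ℝ E := by
  rw [hg.metricTrace_eq_trace (c • LinearMap.id) fun u v => by simp [hg.smul_left], map_smul,
    LinearMap.trace_id, smul_eq_mul]

theorem metricTrace_mul_mul {c : ℝ} (hc : c ≠ 0) {g : E → E → ℝ} (hg : IsScalarProduct g)
    (B : E → E → ℝ) :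
    metricTrace (fun u v => c * g u v) (fun u v => c * B u v) = metricTrace g B := by
  have h : gram (fun u v => c * g u v) = Units.mk0 c hc • gram g := by
    ext i j
    simp [gram, Units.smul_def]
  simp only [metricTrace, h, Matrix.inv_smul' (gram g) (Units.mk0 c hc) hg.isUnit_det_gram]
  refine Finset.sum_congr rfl fun i _ => Finset.sum_congr rfl fun j _ => ?_
  simp [Units.smul_def]
  field_simp

theorem differentiableAt_sqrt_det_gram {F : Type*} [NormedAddCommGroup F] [NormedSpace ℝ F]
    {g : F → E → E → ℝ} {x : F} (h : ∀ u v, DifferentiableAt ℝ (fun z => g z u v) x)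
    (hx : IsScalarProduct (g x)) : DifferentiableAt ℝ (fun z => √(gram (g z)).det) x :=
  (differentiableAt_det fun i j => h (finBasis ℝ E i) (finBasis ℝ E j)).sqrt hx.det_gram_pos.ne'

theorem LegendrianOn.differentiableAt_inducedMetric {m : ℕ} {f : E → CSpace m} {U : Set E}
    (hf : LegendrianOn f U) {x : E} (hx : x ∈ U) (u v : E) :
    DifferentiableAt ℝ (fun z => inducedMetric euclidean f z u v) x :=
  Complex.reCLM.differentiableAt.comp x
    (DifferentiableAt.inner ℂ (hf.differentiableAt_fderiv hx _) (hf.differentiableAt_fderiv hx _))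

/-- The cubic form with a fixed last argument, as a bilinear map. -/
def LegendrianOn.cubicBilin {m : ℕ} {f : E → CSpace m} {U : Set E}
    (hf : LegendrianOn f U) {x : E} (hx : x ∈ U) (w : E) : E →ₗ[ℝ] E →ₗ[ℝ] ℝ :=
  LinearMap.mk₂ ℝ (fun u v => cubicForm f x u v w)
    (fun u u' v => by simp [cubicForm, hf.secondDeriv_eq hx])
    (fun c u v => by simp [cubicForm, hf.secondDeriv_eq hx])
    (fun u v v' => by simp [cubicForm, hf.secondDeriv_eq hx])
    (fun c u v => by simp [cubicForm, hf.secondDeriv_eq hx])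

end MetricTraceLemmas

/-! ### An immersion multiplied by a circle of variable phase. -/

section Twist

/-- The circle of radius `c` traversed with angular velocity `β`. -/
def twist (c β θ : ℝ) : ℂ := c * Complex.exp (Complex.I * (β * θ : ℝ))

theorem conj_twist_mul_twist (c β θ : ℝ) :
    (starRingEnd ℂ) (twist c β θ) * twist c β θ = (c ^ 2 : ℝ) := by
  have h : ‖Complex.exp (Complex.I * (β * θ : ℝ))‖ = 1 := by
    rw [mul_comm, Complex.norm_exp_ofReal_mul_I]
  rw [mul_comm, Complex.mul_conj, Complex.normSq_eq_norm_sq, twist, norm_mul, h, mul_one,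
    Complex.norm_real, Real.norm_eq_abs, sq_abs]

theorem inner_twist_smul {m : ℕ} (c β θ : ℝ) (ξ η : CSpace m) :
    inner ℂ (twist c β θ • ξ) (twist c β θ • η) = (c ^ 2 : ℝ) * inner ℂ ξ η := by
  rw [inner_smul_left, inner_smul_right, ← mul_assoc, conj_twist_mul_twist]

theorem hasDerivAt_twist (c β θ : ℝ) :
    HasDerivAt (twist c β) (Complex.I * β * twist c β θ) θ := by
  have h1 : HasDerivAt (fun θ : ℝ => Complex.I * ((β * θ : ℝ) : ℂ)) (Complex.I * β) θ := by
    have := (((hasDerivAt_id θ).const_mul β).ofReal_comp).const_mul Complex.I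
    simpa using this
  have h2 : HasDerivAt (twist c β) _ θ := h1.cexp.const_mul (c : ℂ)
  convert h2 using 1
  simp only [twist]
  ring

theorem contDiff_twist (c β : ℝ) : ContDiff ℝ ∞ (twist c β) := by
  unfold twist
  have h : ContDiff ℝ ∞ fun θ : ℝ => ((β * θ : ℝ) : ℂ) :=
    Complex.ofRealCLM.contDiff.comp (contDiff_const.mul contDiff_id)
  exact contDiff_const.mul (contDiff_const.mul h).cexp

variable {E : Type*} [NormedAddCommGroup E] [NormedSpace ℝ E] {m : ℕ}

theorem fderiv_twist_smul (c β : ℝ) {θ : E → ℝ} {φ : E → CSpace m} {z : E}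
    (hθ : DifferentiableAt ℝ θ z) (hφ : DifferentiableAt ℝ φ z) (v : E) :
    fderiv ℝ (fun z => twist c β (θ z) • φ z) z v =
      twist c β (θ z) • ((Complex.I * β * fderiv ℝ θ z v) • φ z + fderiv ℝ φ z v) := by
  have h1 : HasFDerivAt (fun z => twist c β (θ z)) _ z :=
    (hasDerivAt_twist c β (θ z)).hasFDerivAt.comp z hθ.hasFDerivAt
  have h2 := (h1.fun_smul hφ.hasFDerivAt).fderiv
  rw [h2]
  simp [smul_smul]
  rw [add_comm]
  congr 2
  ring

theorem differentiableAt_twist_smul (c β : ℝ) {θ : E → ℝ} {φ : E → CSpace m} {z : E}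
    (hθ : DifferentiableAt ℝ θ z) (hφ : DifferentiableAt ℝ φ z) :
    DifferentiableAt ℝ (fun z => twist c β (θ z) • φ z) z :=
  (((contDiff_twist c β).differentiable (by simp) _).comp z hθ).fun_smul hφ

theorem secondDeriv_twist_smul (c β : ℝ) {θ : E → ℝ} {φ : E → CSpace m} {z : E}
    (hθ : ContDiffAt ℝ ∞ θ z) (hφ : ContDiffAt ℝ ∞ φ z) (u v : E) :
    secondDeriv (fun z => twist c β (θ z) • φ z) z u v = twist c β (θ z) •
      ((Complex.I * β * fderiv ℝ θ z u) • ((Complex.I * β * fderiv ℝ θ z v) • φ z + fderiv ℝ φ z v) +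
        ((Complex.I * β * fderiv ℝ (fun z => fderiv ℝ θ z v) z u) • φ z +
          (Complex.I * β * fderiv ℝ θ z v) • fderiv ℝ φ z u + secondDeriv φ z u v)) := by
  have h1 : ∀ᶠ z' in 𝓝 z, fderiv ℝ (fun z => twist c β (θ z) • φ z) z' v =
      twist c β (θ z') • ((Complex.I * β * fderiv ℝ θ z' v) • φ z' + fderiv ℝ φ z' v) := by
    filter_upwards [(hθ.of_le (m := 1) ENat.LEInfty.out).eventually (by simp),
      (hφ.of_le (m := 1) ENat.LEInfty.out).eventually (by simp)] with z' k₁ k₂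
    exact fderiv_twist_smul c β (k₁.differentiableAt (by simp)) (k₂.differentiableAt (by simp)) v
  have dθ := hθ.differentiableAt (n := ∞) (by simp)
  have dφ := hφ.differentiableAt (n := ∞) (by simp)
  have dθ' : DifferentiableAt ℝ (fun z => fderiv ℝ θ z v) z :=
    ((hθ.fderiv_right (m := ∞) (by simp)).clm_apply contDiffAt_const).differentiableAt (by simp)
  have dφ' : DifferentiableAt ℝ (fun z => fderiv ℝ φ z v) z :=
    ((hφ.fderiv_right (m := ∞) (by simp)).clm_apply contDiffAt_const).differentiableAt (by simp)
  have d1 : DifferentiableAt ℝ (fun z => Complex.I * β * (fderiv ℝ θ z v : ℂ)) z :=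
    (Complex.ofRealCLM.differentiableAt.comp z dθ').const_mul _
  have e1 : fderiv ℝ (fun z => Complex.I * β * (fderiv ℝ θ z v : ℂ)) z u =
      Complex.I * β * fderiv ℝ (fun z => fderiv ℝ θ z v) z u := by
    have h := ((Complex.ofRealCLM.hasFDerivAt.comp z dθ'.hasFDerivAt).const_mul
      (Complex.I * β)).fderiv
    simp only [Function.comp_def] at h
    exact congrArg (fun L : E →L[ℝ] ℂ => L u) h
  have d2 := d1.fun_smul dφ
  rw [secondDeriv, Filter.EventuallyEq.fderiv_eq h1, fderiv_twist_smul c β dθ (d2.fun_add dφ'),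
    fderiv_fun_add d2 dφ', add_apply, fderiv_fun_smul d1 dφ]
  simp [e1, secondDeriv]
  abel_nf

variable [FiniteDimensional ℝ E] {E₁ : Type*} [NormedAddCommGroup E₁] [NormedSpace ℝ E₁]
  [FiniteDimensional ℝ E₁]

theorem fderiv_comp_clm {F : Type*} [NormedAddCommGroup F] [NormedSpace ℝ F] (π : E →L[ℝ] E₁)
    {f : E₁ → F} {z : E} (hf : DifferentiableAt ℝ f (π z)) (v : E) :
    fderiv ℝ (fun z => f (π z)) z v = fderiv ℝ f (π z) (π v) := by
  have h := (hf.hasFDerivAt.comp z π.hasFDerivAt).fderiv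
  exact congrArg (fun L : E →L[ℝ] F => L v) h

namespace LegendrianOn

variable {f : E₁ → CSpace m} {U : Set E₁} (hf : LegendrianOn f U) (π : E →L[ℝ] E₁) (c β : ℝ)
  {θ : E → ℝ} {z : E} (hz : π z ∈ U) (hθ : ContDiffAt ℝ ∞ θ z)
include hf hz

theorem contDiffAt_comp_clm : ContDiffAt ℝ ∞ (fun z => f (π z)) z :=
  (hf.contDiffAt hz).comp z π.contDiff.contDiffAt

include hθ

theorem differentiableAt_twist_comp :
    DifferentiableAt ℝ (fun z => twist c β (θ z) • f (π z)) z :=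
  differentiableAt_twist_smul c β (hθ.differentiableAt (by simp))
    ((hf.contDiffAt_comp_clm π hz).differentiableAt (by simp))

theorem contDiffAt_twist_comp : ContDiffAt ℝ ∞ (fun z => twist c β (θ z) • f (π z)) z :=
  ((contDiff_twist c β).contDiffAt.comp z hθ).smul (hf.contDiffAt_comp_clm π hz)

theorem fderiv_twist_comp (v : E) :
    fderiv ℝ (fun z => twist c β (θ z) • f (π z)) z v =
      twist c β (θ z) • ((Complex.I * β * fderiv ℝ θ z v) • f (π z) + fderiv ℝ f (π z) (π v)) := by
  rw [fderiv_twist_smul c β (hθ.differentiableAt (by simp))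
    ((hf.contDiffAt_comp_clm π hz).differentiableAt (by simp)), fderiv_comp_clm π (hf.differentiableAt hz)]

/-- The amount by which a twisted Legendrian immersion fails to be orthogonal to its derivatives. In
the join of two of them these terms are made to cancel. -/
theorem inner_twist_fderiv (v : E) :
    inner ℂ (twist c β (θ z) • f (π z)) (fderiv ℝ (fun z => twist c β (θ z) • f (π z)) z v) =
      Complex.I * (c ^ 2 * β * fderiv ℝ θ z v : ℝ) := by
  rw [hf.fderiv_twist_comp π c β hz hθ, inner_twist_smul, inner_add_right, inner_smul_right,
    hf.inner_self hz, hf.inner_fderiv _ hz]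
  push_cast
  ring

theorem re_inner_fderiv_twist (u v : E) :
    (inner ℂ (fderiv ℝ (fun z => twist c β (θ z) • f (π z)) z u)
      (fderiv ℝ (fun z => twist c β (θ z) • f (π z)) z v)).re =
      c ^ 2 * (β ^ 2 * (fderiv ℝ θ z u * fderiv ℝ θ z v) +
        inducedMetric euclidean f (π z) (π u) (π v)) := by
  rw [hf.fderiv_twist_comp π c β hz hθ, hf.fderiv_twist_comp π c β hz hθ, inner_twist_smul,
    Complex.re_ofReal_mul]
  congr 1
  simp only [inner_add_left, inner_add_right, inner_smul_left, inner_smul_right, hf.inner_self hz,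
    hf.inner_fderiv _ hz, hf.inner_fderiv_left hz, hf.inner_fderiv_fderiv hz, map_mul,
    Complex.conj_I, Complex.conj_ofReal]
  simp
  ring

/-- Each derivative falling on the phase contributes a factor iβ dθ. If all three do, the result is
the β³ term; if exactly one does, it is -β dθ times the metric of the other two arguments; if
exactly two do, ⟨f, f_*·⟩ = 0 appears. The term with D²θ has no imaginary part. -/
theorem im_inner_secondDeriv_twist (u v w : E) :
    (inner ℂ (secondDeriv (fun z => twist c β (θ z) • f (π z)) z u v)
      (fderiv ℝ (fun z => twist c β (θ z) • f (π z)) z w)).im =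
      c ^ 2 * (cubicForm f (π z) (π u) (π v) (π w)
        - β ^ 3 * (fderiv ℝ θ z u * fderiv ℝ θ z v * fderiv ℝ θ z w)
        - β * fderiv ℝ θ z u * inducedMetric euclidean f (π z) (π v) (π w)
        - β * fderiv ℝ θ z v * inducedMetric euclidean f (π z) (π u) (π w)
        - β * fderiv ℝ θ z w * inducedMetric euclidean f (π z) (π u) (π v)) := by
  have h1 : secondDeriv (fun z => f (π z)) z u v = secondDeriv f (π z) (π u) (π v) := by
    have h : (fun z => fderiv ℝ (fun z => f (π z)) z v) =ᶠ[𝓝 z]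
        fun z => fderiv ℝ f (π z) (π v) := by
      filter_upwards [π.continuous.continuousAt.preimage_mem_nhds (hf.mem_nhds hz)] with z' hz'
      exact fderiv_comp_clm π (hf.differentiableAt hz') v
    rw [secondDeriv, h.fderiv_eq]
    exact fderiv_comp_clm π (f := fun x => fderiv ℝ f x (π v))
      (hf.differentiableAt_fderiv hz (π v)) u
  have h2 : inner ℂ (secondDeriv f (π z) (π u) (π v)) (f (π z)) =
      -(inducedMetric euclidean f (π z) (π u) (π v) : ℂ) := by
    rw [← inner_conj_symm, hf.inner_secondDeriv hz, hf.inner_fderiv_fderiv hz, map_neg,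
      Complex.conj_ofReal]
  rw [hf.fderiv_twist_comp π c β hz hθ, secondDeriv_twist_smul c β hθ
    (hf.contDiffAt_comp_clm π hz), inner_twist_smul, Complex.im_ofReal_mul, h1,
    fderiv_comp_clm π (hf.differentiableAt hz), fderiv_comp_clm π (hf.differentiableAt hz)]
  congr 1
  simp only [inner_add_left, inner_add_right, inner_smul_left, inner_smul_right, hf.inner_self hz,
    hf.inner_fderiv _ hz, hf.inner_fderiv_left hz, hf.inner_fderiv_fderiv hz, h2, map_mul,
    Complex.conj_I, Complex.conj_ofReal, cubicForm]
  simp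
  ring

end LegendrianOn

end Twist

/-! ### The orthogonal sum of the two complex vector spaces. -/

section Join

variable {n₁ n₂ : ℕ}

/-- The isomorphism `ℂ^{n₁+1} × ℂ^{n₂+1} → ℂ^{n+1}`, `n = n₁ + n₂ + 1`. -/
def join : CSpace (n₁ + 1) × CSpace (n₂ + 1) →ₗ[ℂ] CSpace (n₁ + n₂ + 1 + 1) where
  toFun p := pairVec 1 1 p.1 p.2
  map_add' p q := by
    ext k
    simp only [pairVec, one_smul, PiLp.add_apply]
    generalize k.cast (by omega : n₁ + n₂ + 1 + 1 = n₁ + 1 + (n₂ + 1)) = l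
    refine Fin.addCases (fun i => ?_) (fun i => ?_) l <;> simp
  map_smul' c p := by
    ext k
    simp only [pairVec, one_smul, PiLp.smul_apply, RingHom.id_apply]
    generalize k.cast (by omega : n₁ + n₂ + 1 + 1 = n₁ + 1 + (n₂ + 1)) = l
    refine Fin.addCases (fun i => ?_) (fun i => ?_) l <;> simp

theorem pairVec_eq_join (a b : ℂ) (x : CSpace (n₁ + 1)) (y : CSpace (n₂ + 1)) :
    pairVec a b x y = join (a • x, b • y) := by
  change _ = pairVec 1 1 (a • x) (b • y)
  simp [pairVec]

theorem inner_join (p q : CSpace (n₁ + 1) × CSpace (n₂ + 1)) :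
    inner ℂ (join p) (join q) = inner ℂ p.1 q.1 + inner ℂ p.2 q.2 := by
  have h : n₁ + n₂ + 1 + 1 = n₁ + 1 + (n₂ + 1) := by omega
  change inner ℂ (pairVec 1 1 p.1 p.2) (pairVec 1 1 q.1 q.2) = _
  simp only [PiLp.inner_apply, pairVec]
  rw [← Equiv.sum_comp (finCongr h.symm), Fin.sum_univ_add]
  simp

/-- `join` as a continuous real linear map. -/
def joinCLM : CSpace (n₁ + 1) × CSpace (n₂ + 1) →L[ℝ] CSpace (n₁ + n₂ + 1 + 1) :=
  LinearMap.toContinuousLinearMap (join.restrictScalars ℝ)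

variable {E : Type*} [NormedAddCommGroup E] [NormedSpace ℝ E]
  {G₁ : E → CSpace (n₁ + 1)} {G₂ : E → CSpace (n₂ + 1)} {z : E}

theorem fderiv_join (h₁ : DifferentiableAt ℝ G₁ z) (h₂ : DifferentiableAt ℝ G₂ z) (v : E) :
    fderiv ℝ (fun z => join (G₁ z, G₂ z)) z v = join (fderiv ℝ G₁ z v, fderiv ℝ G₂ z v) := by
  have h := (joinCLM.hasFDerivAt.comp z (h₁.hasFDerivAt.prodMk h₂.hasFDerivAt)).fderiv
  exact congrArg (fun L : E →L[ℝ] CSpace (n₁ + n₂ + 1 + 1) => L v) h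

theorem contDiffAt_join (h₁ : ContDiffAt ℝ ∞ G₁ z) (h₂ : ContDiffAt ℝ ∞ G₂ z) :
    ContDiffAt ℝ ∞ (fun z => join (G₁ z, G₂ z)) z :=
  joinCLM.contDiff.contDiffAt.comp z (h₁.prodMk h₂)

theorem secondDeriv_join (h₁ : ContDiffAt ℝ ∞ G₁ z) (h₂ : ContDiffAt ℝ ∞ G₂ z) (u v : E) :
    secondDeriv (fun z => join (G₁ z, G₂ z)) z u v =
      join (secondDeriv G₁ z u v, secondDeriv G₂ z u v) := by
  have h : (fun z => fderiv ℝ (fun z => join (G₁ z, G₂ z)) z v) =ᶠ[𝓝 z]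
      fun z => join (fderiv ℝ G₁ z v, fderiv ℝ G₂ z v) := by
    filter_upwards [(h₁.of_le (m := 1) ENat.LEInfty.out).eventually (by simp),
      (h₂.of_le (m := 1) ENat.LEInfty.out).eventually (by simp)] with z' k₁ k₂
    exact fderiv_join (k₁.differentiableAt (by simp)) (k₂.differentiableAt (by simp)) v
  rw [secondDeriv, h.fderiv_eq]
  exact fderiv_join
    (((h₁.fderiv_right (m := ∞) (by simp)).clm_apply contDiffAt_const).differentiableAt (by simp))
    (((h₂.fderiv_right (m := ∞) (by simp)).clm_apply contDiffAt_const).differentiableAt (by simp)) u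

end Join

/-! ### The lift in product form: its metric and cubic form. -/

section ProductLift

variable {E₀ E₁ E₂ : Type*} [NormedAddCommGroup E₀] [NormedSpace ℝ E₀] [FiniteDimensional ℝ E₀]
  [NormedAddCommGroup E₁] [NormedSpace ℝ E₁] [FiniteDimensional ℝ E₁]
  [NormedAddCommGroup E₂] [NormedSpace ℝ E₂] [FiniteDimensional ℝ E₂]
  {n₁ n₂ : ℕ}

/-- `s` is a smooth function without critical points on the open set `U` of a line. -/
structure IsPhaseOn (s : E₀ → ℝ) (U : Set E₀) : Prop where
  finrank_eq : finrank ℝ E₀ = 1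
  isOpen : IsOpen U
  contDiffOn : ContDiffOn ℝ ∞ s U
  fderiv_ne_zero : ∀ t ∈ U, fderiv ℝ s t ≠ 0

/-- The metric of the circle factor. -/
def phaseMetric (c : ℝ) (s : E₀ → ℝ) (t u v : E₀) : ℝ := c * (fderiv ℝ s t u * fderiv ℝ s t v)

/-- A basis vector of a line. -/
def lineVec (E₀ : Type*) [NormedAddCommGroup E₀] [NormedSpace ℝ E₀] [FiniteDimensional ℝ E₀]
    (h : finrank ℝ E₀ = 1) : E₀ := finBasis ℝ E₀ (finCongr h.symm 0)

theorem exists_eq_smul_lineVec (h : finrank ℝ E₀ = 1) (v : E₀) : ∃ r : ℝ, v = r • lineVec E₀ h := by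
  refine ⟨(finBasis ℝ E₀).repr v (finCongr h.symm 0), ?_⟩
  have : Unique (Fin (finrank ℝ E₀)) := (finCongr h).unique
  conv_lhs => rw [← (finBasis ℝ E₀).sum_repr v]
  rw [Fintype.sum_unique, lineVec, Subsingleton.elim (finCongr h.symm 0) default]

/-- The vector field of the line on which `ds` takes the value `1`. -/
def unitField (s : E₀ → ℝ) (h : finrank ℝ E₀ = 1) (t : E₀) : E₀ :=
  (fderiv ℝ s t (lineVec E₀ h))⁻¹ • lineVec E₀ h

namespace IsPhaseOn

variable {s : E₀ → ℝ} {U : Set E₀} (hs : IsPhaseOn s U) {t : E₀} (ht : t ∈ U)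
include hs ht

theorem contDiffAt : ContDiffAt ℝ ∞ s t := hs.contDiffOn.contDiffAt (hs.isOpen.mem_nhds ht)

theorem fderiv_lineVec_ne_zero : fderiv ℝ s t (lineVec E₀ hs.finrank_eq) ≠ 0 := fun h => by
  refine hs.fderiv_ne_zero t ht (ContinuousLinearMap.ext fun v => ?_)
  obtain ⟨r, rfl⟩ := exists_eq_smul_lineVec hs.finrank_eq v
  rw [map_smul, h, smul_zero, zero_apply]

theorem isScalarProduct {c : ℝ} (hc : 0 < c) : IsScalarProduct (phaseMetric c s t) where
  add_left u u' v := by rw [phaseMetric, phaseMetric, phaseMetric, map_add]; ring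
  smul_left a u v := by rw [phaseMetric, phaseMetric, map_smul, smul_eq_mul]; ring
  symm u v := by rw [phaseMetric, phaseMetric]; ring
  pos u hu := by
    obtain ⟨r, rfl⟩ := exists_eq_smul_lineVec hs.finrank_eq u
    have h1 := hs.fderiv_lineVec_ne_zero ht
    have h2 : r ≠ 0 := fun h => hu (by rw [h, zero_smul])
    rw [phaseMetric, map_smul, smul_eq_mul]
    exact mul_pos hc (mul_self_pos.2 (mul_ne_zero h2 h1))

theorem differentiableAt_fderiv (v : E₀) : DifferentiableAt ℝ (fun t => fderiv ℝ s t v) t :=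
  (((hs.contDiffAt ht).fderiv_right (m := ∞) (by simp)).clm_apply
    contDiffAt_const).differentiableAt (by simp)

theorem differentiableAt_phaseMetric (c : ℝ) (u v : E₀) :
    DifferentiableAt ℝ (fun t => phaseMetric c s t u v) t :=
  ((hs.differentiableAt_fderiv ht u).fun_mul (hs.differentiableAt_fderiv ht v)).const_mul c

theorem fderiv_unitField : fderiv ℝ s t (unitField s hs.finrank_eq t) = 1 := by
  rw [unitField, map_smul, smul_eq_mul, inv_mul_cancel₀ (hs.fderiv_lineVec_ne_zero ht)]

theorem differentiableAt_unitField : DifferentiableAt ℝ (unitField s hs.finrank_eq) t :=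
  ((hs.differentiableAt_fderiv ht _).inv (hs.fderiv_lineVec_ne_zero ht)).smul_const _

/-- The density is √c |ds(e)| and the coefficient of the field is 1/ds(e). Their product is ±√c, and
the sign of ds(e) is locally constant. -/
theorem divergence_unitField {c : ℝ} (hc : 0 < c) :
    divergence (phaseMetric c s) (unitField s hs.finrank_eq) t = 0 := by
  have hu : Unique (Fin (finrank ℝ E₀)) := (finCongr hs.finrank_eq).unique
  set e := lineVec E₀ hs.finrank_eq with he
  have hdef : finBasis ℝ E₀ default = e := by
    rw [he, lineVec, Subsingleton.elim (finCongr hs.finrank_eq.symm 0) default]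
  have hdet : ∀ t, √(gram (phaseMetric c s t)).det = √c * |fderiv ℝ s t e| := fun t => by
    rw [Matrix.det_unique, gram, Matrix.of_apply, hdef, phaseMetric, Real.sqrt_mul hc.le,
      Real.sqrt_mul_self_eq_abs]
  have hconst : ∃ a : E₀, (fun z => √(gram (phaseMetric c s z)).det • unitField s hs.finrank_eq z)
      =ᶠ[𝓝 t] fun _ => a := by
    have hcont := (hs.differentiableAt_fderiv ht e).continuousAt
    rcases lt_or_gt_of_ne (hs.fderiv_lineVec_ne_zero ht) with h | h
    · refine ⟨-(√c • e), ?_⟩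
      filter_upwards [hcont.eventually_lt_const h] with z hz
      rw [hdet, unitField, ← he, abs_of_neg hz, smul_smul, ← neg_smul]
      congr 1
      have := hz.ne
      field_simp
    · refine ⟨√c • e, ?_⟩
      filter_upwards [hcont.eventually_const_lt h] with z hz
      rw [hdet, unitField, ← he, abs_of_pos hz, smul_smul]
      congr 1
      have := hz.ne'
      field_simp
  obtain ⟨a, ha⟩ := hconst
  rw [divergence_eq_trace ha (differentiableAt_const a)]
  simp

end IsPhaseOn

/-- The horizontal lift
`(cos δ exp(i s(t) sin² δ) f₁(x), sin δ exp(-i s(t) cos² δ) f₂(y))`. -/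
def productLift (δ : ℝ) (s : E₀ → ℝ) (f₁ : E₁ → CSpace (n₁ + 1)) (f₂ : E₂ → CSpace (n₂ + 1))
    (z : E₀ × E₁ × E₂) : CSpace (n₁ + n₂ + 1 + 1) :=
  join (twist (Real.cos δ) (Real.sin δ ^ 2) (s z.1) • f₁ z.2.1,
    twist (Real.sin δ) (-Real.cos δ ^ 2) (s z.1) • f₂ z.2.2)

/-- The metric `cos² δ g₁ + sin² δ g₂`. -/
def weightedMetric (δ : ℝ) (f₁ : E₁ → CSpace (n₁ + 1)) (f₂ : E₂ → CSpace (n₂ + 1))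
    (z u v : E₁ × E₂) : ℝ :=
  Real.cos δ ^ 2 * inducedMetric euclidean f₁ z.1 u.1 v.1 +
    Real.sin δ ^ 2 * inducedMetric euclidean f₂ z.2 u.2 v.2

section

variable {δ : ℝ} (hδ : δ ∈ Ioo 0 (Real.pi / 2)) {s : E₀ → ℝ} {U₀ : Set E₀} (hs : IsPhaseOn s U₀)
  {f₁ : E₁ → CSpace (n₁ + 1)} {U₁ : Set E₁} (h₁ : LegendrianOn f₁ U₁)
  {f₂ : E₂ → CSpace (n₂ + 1)} {U₂ : Set E₂} (h₂ : LegendrianOn f₂ U₂)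
  {z : E₀ × E₁ × E₂} (hz : z ∈ U₀ ×ˢ U₁ ×ˢ U₂)

include hδ in
theorem cos_sq_pos : 0 < Real.cos δ ^ 2 :=
  pow_pos (Real.cos_pos_of_mem_Ioo ⟨by linarith [hδ.1, Real.pi_pos], hδ.2⟩) 2

include hδ in
theorem sin_sq_pos : 0 < Real.sin δ ^ 2 :=
  pow_pos (Real.sin_pos_of_pos_of_lt_pi hδ.1 (by linarith [hδ.2, Real.pi_pos])) 2

include hs hz in
theorem contDiffAt_phase_fst : ContDiffAt ℝ ∞ (fun z : E₀ × E₁ × E₂ => s z.1) z :=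
  (hs.contDiffAt hz.1).comp z contDiffAt_fst

include hs hz in
theorem fderiv_phase_fst (v : E₀ × E₁ × E₂) :
    fderiv ℝ (fun z : E₀ × E₁ × E₂ => s z.1) z v = fderiv ℝ s z.1 v.1 :=
  fderiv_comp_clm (ContinuousLinearMap.fst ℝ E₀ (E₁ × E₂))
    ((hs.contDiffAt hz.1).differentiableAt (by simp)) v

variable (E₀ E₁ E₂) in
/-- The projection to the second factor of three. -/
abbrev projFst : E₀ × E₁ × E₂ →L[ℝ] E₁ :=
  (ContinuousLinearMap.fst ℝ E₁ E₂).comp (ContinuousLinearMap.snd ℝ E₀ (E₁ × E₂))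

variable (E₀ E₁ E₂) in
/-- The projection to the third factor of three. -/
abbrev projSnd : E₀ × E₁ × E₂ →L[ℝ] E₂ :=
  (ContinuousLinearMap.snd ℝ E₁ E₂).comp (ContinuousLinearMap.snd ℝ E₀ (E₁ × E₂))

include hs h₁ h₂ hz

theorem contDiffAt_productLift : ContDiffAt ℝ ∞ (productLift δ s f₁ f₂) z :=
  contDiffAt_join
    (h₁.contDiffAt_twist_comp (projFst E₀ E₁ E₂) _ _ hz.2.1 (contDiffAt_phase_fst hs hz))
    (h₂.contDiffAt_twist_comp (projSnd E₀ E₁ E₂) _ _ hz.2.2 (contDiffAt_phase_fst hs hz))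

theorem fderiv_productLift (v : E₀ × E₁ × E₂) : fderiv ℝ (productLift δ s f₁ f₂) z v =
    join (fderiv ℝ (fun z : E₀ × E₁ × E₂ =>
        twist (Real.cos δ) (Real.sin δ ^ 2) (s z.1) • f₁ (projFst E₀ E₁ E₂ z)) z v,
      fderiv ℝ (fun z : E₀ × E₁ × E₂ =>
        twist (Real.sin δ) (-Real.cos δ ^ 2) (s z.1) • f₂ (projSnd E₀ E₁ E₂ z)) z v) :=
  fderiv_join
    (h₁.differentiableAt_twist_comp (projFst E₀ E₁ E₂) _ _ hz.2.1 (contDiffAt_phase_fst hs hz))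
    (h₂.differentiableAt_twist_comp (projSnd E₀ E₁ E₂) _ _ hz.2.2 (contDiffAt_phase_fst hs hz)) v

theorem secondDeriv_productLift (u v : E₀ × E₁ × E₂) :
    secondDeriv (productLift δ s f₁ f₂) z u v =
    join (secondDeriv (fun z : E₀ × E₁ × E₂ =>
        twist (Real.cos δ) (Real.sin δ ^ 2) (s z.1) • f₁ (projFst E₀ E₁ E₂ z)) z u v,
      secondDeriv (fun z : E₀ × E₁ × E₂ =>
        twist (Real.sin δ) (-Real.cos δ ^ 2) (s z.1) • f₂ (projSnd E₀ E₁ E₂ z)) z u v) :=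
  secondDeriv_join
    (h₁.contDiffAt_twist_comp (projFst E₀ E₁ E₂) _ _ hz.2.1 (contDiffAt_phase_fst hs hz))
    (h₂.contDiffAt_twist_comp (projSnd E₀ E₁ E₂) _ _ hz.2.2 (contDiffAt_phase_fst hs hz)) u v

/-- This fixes the phases: cos²δ · sin²δ + sin²δ · (-cos²δ) = 0. -/
theorem inner_productLift_fderiv (v : E₀ × E₁ × E₂) :
    inner ℂ (productLift δ s f₁ f₂ z) (fderiv ℝ (productLift δ s f₁ f₂) z v) = 0 := by
  have e₁ := h₁.inner_twist_fderiv (projFst E₀ E₁ E₂) (Real.cos δ) (Real.sin δ ^ 2) hz.2.1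
    (contDiffAt_phase_fst hs hz) v
  have e₂ := h₂.inner_twist_fderiv (projSnd E₀ E₁ E₂) (Real.sin δ) (-Real.cos δ ^ 2) hz.2.2
    (contDiffAt_phase_fst hs hz) v
  rw [fderiv_productLift hs h₁ h₂ hz, productLift, inner_join]
  refine (congrArg₂ (· + ·) e₁ e₂).trans ?_
  push_cast
  ring

theorem inducedMetric_productLift : inducedMetric euclidean (productLift δ s f₁ f₂) z =
    fun u v => phaseMetric (Real.cos δ ^ 2 * Real.sin δ ^ 2) s z.1 u.1 v.1 +
      weightedMetric δ f₁ f₂ z.2 u.2 v.2 := by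
  funext u v
  rw [inducedMetric, euclidean, fderiv_productLift hs h₁ h₂ hz, fderiv_productLift hs h₁ h₂ hz,
    inner_join, Complex.add_re,
    h₁.re_inner_fderiv_twist (projFst E₀ E₁ E₂) _ _ hz.2.1 (contDiffAt_phase_fst hs hz),
    h₂.re_inner_fderiv_twist (projSnd E₀ E₁ E₂) _ _ hz.2.2 (contDiffAt_phase_fst hs hz),
    fderiv_phase_fst hs hz, fderiv_phase_fst hs hz, phaseMetric, weightedMetric]
  have h := Real.sin_sq_add_cos_sq δ
  simp only [ContinuousLinearMap.comp_apply, ContinuousLinearMap.coe_fst', ContinuousLinearMap.coe_snd']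
  -- The coefficient of ds² is cos²δ sin⁴δ + sin²δ cos⁴δ = cos²δ sin²δ.
  linear_combination (Real.cos δ ^ 2 * Real.sin δ ^ 2) * (fderiv ℝ s z.1 u.1 * fderiv ℝ s z.1 v.1) * h

/-- The first term is written as a multiple of `phaseMetric`, and the others as cubic forms and
metrics of the factors, so that the trace over each factor is immediate. -/
theorem cubicForm_productLift (u v w : E₀ × E₁ × E₂) :
    cubicForm (productLift δ s f₁ f₂) z u v w =
      (Real.cos δ ^ 2 - Real.sin δ ^ 2) * fderiv ℝ s z.1 w.1 *
          phaseMetric (Real.cos δ ^ 2 * Real.sin δ ^ 2) s z.1 u.1 v.1 +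
        Real.cos δ ^ 2 * (cubicForm f₁ z.2.1 u.2.1 v.2.1 w.2.1
          - Real.sin δ ^ 2 * (fderiv ℝ s z.1 u.1 * inducedMetric euclidean f₁ z.2.1 v.2.1 w.2.1 +
            fderiv ℝ s z.1 v.1 * inducedMetric euclidean f₁ z.2.1 u.2.1 w.2.1 +
            fderiv ℝ s z.1 w.1 * inducedMetric euclidean f₁ z.2.1 u.2.1 v.2.1)) +
        Real.sin δ ^ 2 * (cubicForm f₂ z.2.2 u.2.2 v.2.2 w.2.2
          + Real.cos δ ^ 2 * (fderiv ℝ s z.1 u.1 * inducedMetric euclidean f₂ z.2.2 v.2.2 w.2.2 +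
            fderiv ℝ s z.1 v.1 * inducedMetric euclidean f₂ z.2.2 u.2.2 w.2.2 +
            fderiv ℝ s z.1 w.1 * inducedMetric euclidean f₂ z.2.2 u.2.2 v.2.2)) := by
  rw [cubicForm, secondDeriv_productLift hs h₁ h₂ hz, fderiv_productLift hs h₁ h₂ hz,
    inner_join, Complex.add_im,
    h₁.im_inner_secondDeriv_twist (projFst E₀ E₁ E₂) _ _ hz.2.1 (contDiffAt_phase_fst hs hz),
    h₂.im_inner_secondDeriv_twist (projSnd E₀ E₁ E₂) _ _ hz.2.2 (contDiffAt_phase_fst hs hz),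
    fderiv_phase_fst hs hz, fderiv_phase_fst hs hz, fderiv_phase_fst hs hz, phaseMetric]
  have h := Real.sin_sq_add_cos_sq δ
  simp only [ContinuousLinearMap.comp_apply, ContinuousLinearMap.coe_fst', ContinuousLinearMap.coe_snd']
  -- The coefficient of ds³ is sin²δ cos⁶δ - cos²δ sin⁶δ = cos²δ sin²δ (cos²δ - sin²δ).
  linear_combination (Real.cos δ ^ 2 * Real.sin δ ^ 2) * (Real.cos δ ^ 2 - Real.sin δ ^ 2) *
    (fderiv ℝ s z.1 u.1 * fderiv ℝ s z.1 v.1 * fderiv ℝ s z.1 w.1) * h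

end

end ProductLift

/-! ### Mean form, minimality and div JH of the lift. -/

section ProductGeometry

variable {E₀ E₁ E₂ : Type*} [NormedAddCommGroup E₀] [NormedSpace ℝ E₀] [FiniteDimensional ℝ E₀]
  [NormedAddCommGroup E₁] [NormedSpace ℝ E₁] [FiniteDimensional ℝ E₁]
  [NormedAddCommGroup E₂] [NormedSpace ℝ E₂] [FiniteDimensional ℝ E₂]
  {n₁ n₂ : ℕ}

theorem inducedMetric_zero_left {m : ℕ} (f : E₁ → CSpace m) (x v : E₁) :
    inducedMetric euclidean f x 0 v = 0 := by simp [inducedMetric, euclidean]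

theorem cubicForm_zero_left {m : ℕ} (f : E₁ → CSpace m) (x v w : E₁) :
    cubicForm f x 0 v w = 0 := by simp [cubicForm, secondDeriv]

variable {δ : ℝ} (hδ : δ ∈ Ioo 0 (Real.pi / 2)) {s : E₀ → ℝ} {U₀ : Set E₀} (hs : IsPhaseOn s U₀)
  {f₁ : E₁ → CSpace (n₁ + 1)} {U₁ : Set E₁} (h₁ : LegendrianOn f₁ U₁)
  {f₂ : E₂ → CSpace (n₂ + 1)} {U₂ : Set E₂} (h₂ : LegendrianOn f₂ U₂)

include hδ h₁ h₂ in
theorem isScalarProduct_weightedMetric {y : E₁ × E₂} (hy : y ∈ U₁ ×ˢ U₂) :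
    IsScalarProduct (weightedMetric δ f₁ f₂ y) :=
  ((h₁.isScalarProduct hy.1).const_mul (cos_sq_pos hδ)).prod
    ((h₂.isScalarProduct hy.2).const_mul (sin_sq_pos hδ))

include hδ hs h₁ h₂

theorem legendrianOn_productLift :
    LegendrianOn (productLift δ s f₁ f₂) (U₀ ×ˢ U₁ ×ˢ U₂) where
  isOpen := hs.isOpen.prod (h₁.isOpen.prod h₂.isOpen)
  contDiffOn z hz := (contDiffAt_productLift hs h₁ h₂ hz).contDiffWithinAt
  norm_eq_one z hz := by
    have h : inner ℂ (productLift δ s f₁ f₂ z) (productLift δ s f₁ f₂ z) = 1 := by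
      rw [productLift, inner_join, inner_twist_smul, inner_twist_smul, h₁.inner_self hz.2.1,
        h₂.inner_self hz.2.2, mul_one, mul_one]
      exact_mod_cast Real.cos_sq_add_sin_sq δ
    rw [inner_self_eq_norm_sq_to_K] at h
    have h' : ‖productLift δ s f₁ f₂ z‖ ^ 2 = 1 := Complex.ofReal_injective (by push_cast; exact h)
    exact (pow_eq_one_iff_of_nonneg (norm_nonneg _) two_ne_zero).1 h'
  injective z hz := by
    rw [injective_iff_map_eq_zero]
    intro v hv
    by_contra hne
    have h := ((hs.isScalarProduct hz.1 (mul_pos (cos_sq_pos hδ) (sin_sq_pos hδ))).prod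
      (isScalarProduct_weightedMetric hδ h₁ h₂ hz.2)).pos v hne
    have h' := congrFun (congrFun (inducedMetric_productLift (δ := δ) hs h₁ h₂ hz) v) v
    rw [inducedMetric, hv] at h'
    simp only [← h', euclidean, inner_zero_left, Complex.zero_re, lt_irrefl] at h
  inner_fderiv z hz v := inner_productLift_fderiv hs h₁ h₂ hz v

variable {z : E₀ × E₁ × E₂} (hz : z ∈ U₀ ×ˢ U₁ ×ˢ U₂)
include hz

/-- The metric is a product, so the trace is the sum over the three factors. The line contributes
(cos²δ - sin²δ) ds, the other two contribute -n₁ sin²δ ds and n₂ cos²δ ds besides their own mean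
forms. This is where n₁ + 1 and n₂ + 1 come from. -/
theorem finrank_mul_meanForm_productLift (w : E₀ × E₁ × E₂) :
    finrank ℝ (E₀ × E₁ × E₂) * meanForm (productLift δ s f₁ f₂) z w =
      (Real.cos δ ^ 2 * (finrank ℝ E₂ + 1) - Real.sin δ ^ 2 * (finrank ℝ E₁ + 1)) *
          fderiv ℝ s z.1 w.1 +
        (finrank ℝ E₁ * meanForm f₁ z.2.1 w.2.1 + finrank ℝ E₂ * meanForm f₂ z.2.2 w.2.2) := by
  have hF := legendrianOn_productLift hδ hs h₁ h₂
  have hc := cos_sq_pos hδ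
  have hsn := sin_sq_pos hδ
  have hP := hs.isScalarProduct hz.1 (mul_pos hc hsn)
  set B := hF.cubicBilin hz w with hB
  have hBval : ∀ u v, B u v = cubicForm (productLift δ s f₁ f₂) z u v w := fun _ _ => rfl
  have t₀ : metricTrace (phaseMetric (Real.cos δ ^ 2 * Real.sin δ ^ 2) s z.1)
      (fun u v => B (u, 0) (v, 0)) =
      (Real.cos δ ^ 2 - Real.sin δ ^ 2) * fderiv ℝ s z.1 w.1 * finrank ℝ E₀ := by
    rw [← hP.metricTrace_mul_self]
    congr 1
    funext u v
    rw [hBval, cubicForm_productLift hs h₁ h₂ hz]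
    simp [inducedMetric_zero_left, cubicForm_zero_left]
  have t₁ : metricTrace (fun u v => Real.cos δ ^ 2 * inducedMetric euclidean f₁ z.2.1 u v)
      (fun u v => B (0, u, 0) (0, v, 0)) = finrank ℝ E₁ * meanForm f₁ z.2.1 w.2.1 +
        -(Real.sin δ ^ 2 * fderiv ℝ s z.1 w.1) * finrank ℝ E₁ := by
    rw [← (h₁.isScalarProduct hz.2.1).metricTrace_mul_self, h₁.finrank_mul_meanForm hz.2.1,
      ← metricTrace_add, ← metricTrace_mul_mul hc.ne' (h₁.isScalarProduct hz.2.1)]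
    congr 1
    funext u v
    rw [hBval, cubicForm_productLift hs h₁ h₂ hz]
    simp [inducedMetric_zero_left, cubicForm_zero_left, phaseMetric]
    left
    ring
  have t₂ : metricTrace (fun u v => Real.sin δ ^ 2 * inducedMetric euclidean f₂ z.2.2 u v)
      (fun u v => B (0, 0, u) (0, 0, v)) = finrank ℝ E₂ * meanForm f₂ z.2.2 w.2.2 +
        (Real.cos δ ^ 2 * fderiv ℝ s z.1 w.1) * finrank ℝ E₂ := by
    rw [← (h₂.isScalarProduct hz.2.2).metricTrace_mul_self, h₂.finrank_mul_meanForm hz.2.2,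
      ← metricTrace_add, ← metricTrace_mul_mul hsn.ne' (h₂.isScalarProduct hz.2.2)]
    congr 1
    funext u v
    rw [hBval, cubicForm_productLift hs h₁ h₂ hz]
    simp [inducedMetric_zero_left, cubicForm_zero_left, phaseMetric]
    left
    ring
  have t₃ := metricTrace_prod ((h₁.isScalarProduct hz.2.1).const_mul hc)
    ((h₂.isScalarProduct hz.2.2).const_mul hsn)
    (B.compl₁₂ (LinearMap.inr ℝ E₀ (E₁ × E₂)) (LinearMap.inr ℝ E₀ (E₁ × E₂)))
  have t₄ := metricTrace_prod hP (isScalarProduct_weightedMetric hδ h₁ h₂ hz.2) B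
  rw [hF.finrank_mul_meanForm hz, inducedMetric_productLift hs h₁ h₂ hz]
  refine t₄.trans ?_
  rw [t₀, hs.finrank_eq]
  refine (congrArg (_ + ·) (t₃.trans (congrArg₂ (· + ·) t₁ t₂))).trans ?_
  push_cast
  ring

theorem meanForm_productLift_eq_zero_iff :
    meanForm (productLift δ s f₁ f₂) z = 0 ↔
      Real.cos δ ^ 2 * (finrank ℝ E₂ + 1) = Real.sin δ ^ 2 * (finrank ℝ E₁ + 1) ∧
        meanForm f₁ z.2.1 = 0 ∧ meanForm f₂ z.2.2 = 0 := by
  have h := finrank_mul_meanForm_productLift hδ hs h₁ h₂ hz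
  have hN : (finrank ℝ (E₀ × E₁ × E₂) : ℝ) ≠ 0 := by
    rw [finrank_prod, hs.finrank_eq]
    positivity
  constructor
  · intro h0
    simp only [h0, LinearMap.zero_apply, mul_zero] at h
    refine ⟨?_, ?_, ?_⟩
    · have := h (unitField s hs.finrank_eq z.1, 0, 0)
      simp only [hs.fderiv_unitField hz.1, map_zero, mul_zero, add_zero, mul_one] at this
      linarith
    · refine LinearMap.ext fun v => ?_
      have := h (0, v, 0)
      simp only [map_zero, mul_zero, add_zero, zero_add] at this
      -- A zero-dimensional factor makes the coefficient vanish, but then its mean form is zero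
      -- anyway.
      rcases mul_eq_zero.1 this.symm with h' | h'
      · have := finrank_zero_iff.1 (Nat.cast_eq_zero.1 h')
        rw [Subsingleton.elim v 0, map_zero, map_zero]
      · exact h'
    · refine LinearMap.ext fun v => ?_
      have := h (0, 0, v)
      simp only [map_zero, mul_zero, zero_add] at this
      rcases mul_eq_zero.1 this.symm with h' | h'
      · have := finrank_zero_iff.1 (Nat.cast_eq_zero.1 h')
        rw [Subsingleton.elim v 0, map_zero, map_zero]
      · exact h'
  · rintro ⟨k₀, k₁, k₂⟩
    refine LinearMap.ext fun w => ?_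
    have := h w
    rw [k₀, k₁, k₂] at this
    simp only [sub_self, zero_mul, LinearMap.zero_apply, mul_zero, add_zero] at this
    exact (mul_eq_zero.1 this).resolve_left hN

/-- Raising the index divides each component by the weight of its factor in the metric: cos²δ sin²δ,
cos²δ and sin²δ. -/
theorem sharp_meanForm_productLift :
    sharp (inducedMetric euclidean (productLift δ s f₁ f₂) z) (meanForm (productLift δ s f₁ f₂) z) =
      (((Real.cos δ ^ 2 * (finrank ℝ E₂ + 1) - Real.sin δ ^ 2 * (finrank ℝ E₁ + 1)) /
          (finrank ℝ (E₀ × E₁ × E₂) * (Real.cos δ ^ 2 * Real.sin δ ^ 2))) •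
            unitField s hs.finrank_eq z.1,
        (finrank ℝ E₁ / (finrank ℝ (E₀ × E₁ × E₂) * Real.cos δ ^ 2) : ℝ) • sphereJH f₁ z.2.1,
        (finrank ℝ E₂ / (finrank ℝ (E₀ × E₁ × E₂) * Real.sin δ ^ 2) : ℝ) • sphereJH f₂ z.2.2) := by
  have hF := legendrianOn_productLift hδ hs h₁ h₂
  have hc : Real.cos δ ≠ 0 := fun h => (cos_sq_pos hδ).ne' (by rw [h, zero_pow two_ne_zero])
  have hsn : Real.sin δ ≠ 0 := fun h => (sin_sq_pos hδ).ne' (by rw [h, zero_pow two_ne_zero])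
  have hN : (finrank ℝ (E₀ × E₁ × E₂) : ℝ) ≠ 0 := by
    rw [finrank_prod, hs.finrank_eq]
    positivity
  refine (hF.isScalarProduct hz).sharp_eq fun w => ?_
  have h := finrank_mul_meanForm_productLift hδ hs h₁ h₂ hz w
  rw [inducedMetric_productLift hs h₁ h₂ hz]
  simp only [phaseMetric, weightedMetric]
  rw [(h₁.isScalarProduct hz.2.1).smul_left, (h₂.isScalarProduct hz.2.2).smul_left,
    h₁.sphereJH_eq_sharp hz.2.1, h₂.sphereJH_eq_sharp hz.2.2,
    (h₁.isScalarProduct hz.2.1).apply_sharp, (h₂.isScalarProduct hz.2.2).apply_sharp, map_smul,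
    hs.fderiv_unitField hz.1, smul_eq_mul, ← mul_right_inj' hN, h]
  field_simp

/-- All coefficients of the field are constant, the field on the line is divergence-free, and
scaling the metrics g₁, g₂ by constants does not change divergences. -/
theorem divergence_productLift :
    divergence (inducedMetric euclidean (productLift δ s f₁ f₂))
        (fun z => sharp (inducedMetric euclidean (productLift δ s f₁ f₂) z)
          (meanForm (productLift δ s f₁ f₂) z)) z =
      finrank ℝ E₁ / (finrank ℝ (E₀ × E₁ × E₂) * Real.cos δ ^ 2) *
          divergence (inducedMetric euclidean f₁) (sphereJH f₁) z.2.1 +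
        finrank ℝ E₂ / (finrank ℝ (E₀ × E₁ × E₂) * Real.sin δ ^ 2) *
          divergence (inducedMetric euclidean f₂) (sphereJH f₂) z.2.2 := by
  have hF := legendrianOn_productLift hδ hs h₁ h₂
  have hc := cos_sq_pos hδ
  have hsn := sin_sq_pos hδ
  set c₀ := (Real.cos δ ^ 2 * (finrank ℝ E₂ + 1) - Real.sin δ ^ 2 * (finrank ℝ E₁ + 1)) /
    (finrank ℝ (E₀ × E₁ × E₂) * (Real.cos δ ^ 2 * Real.sin δ ^ 2)) with hc₀
  set c₁ : ℝ := finrank ℝ E₁ / (finrank ℝ (E₀ × E₁ × E₂) * Real.cos δ ^ 2) with hc₁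
  set c₂ : ℝ := finrank ℝ E₂ / (finrank ℝ (E₀ × E₁ × E₂) * Real.sin δ ^ 2) with hc₂
  have hU := hF.mem_nhds hz
  have j₁ := h₁.differentiableAt_sphereJH hz.2.1
  have j₂ := h₂.differentiableAt_sphereJH hz.2.2
  have r₁ := h₁.differentiableAt_sqrt_det_gram hz.2.1
  have r₂ := h₂.differentiableAt_sqrt_det_gram hz.2.2
  have m₁ : ∀ u v, DifferentiableAt ℝ
      (fun x => Real.cos δ ^ 2 * inducedMetric euclidean f₁ x u v) z.2.1 :=
    fun u v => (h₁.differentiableAt_inducedMetric hz.2.1 u v).const_mul _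
  have m₂ : ∀ u v, DifferentiableAt ℝ
      (fun x => Real.sin δ ^ 2 * inducedMetric euclidean f₂ x u v) z.2.2 :=
    fun u v => (h₂.differentiableAt_inducedMetric hz.2.2 u v).const_mul _
  have hP := hs.isScalarProduct hz.1 (mul_pos hc hsn)
  have hW := isScalarProduct_weightedMetric hδ h₁ h₂ hz.2
  have p₀ : DifferentiableAt ℝ
      (fun t => √(gram (phaseMetric (Real.cos δ ^ 2 * Real.sin δ ^ 2) s t)).det) z.1 :=
    differentiableAt_sqrt_det_gram (hs.differentiableAt_phaseMetric hz.1 _) hP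
  have pW : DifferentiableAt ℝ (fun y => √(gram (weightedMetric δ f₁ f₂ y)).det) z.2 :=
    differentiableAt_sqrt_det_gram (fun u v =>
      ((m₁ u.1 v.1).comp z.2 differentiableAt_fst).fun_add
        ((m₂ u.2 v.2).comp z.2 differentiableAt_snd)) hW
  have dW : DifferentiableAt ℝ (fun y : E₁ × E₂ => (c₁ • sphereJH f₁ y.1, c₂ • sphereJH f₂ y.2))
      z.2 :=
    DifferentiableAt.prodMk ((j₁.const_smul c₁).comp z.2 differentiableAt_fst)
      ((j₂.const_smul c₂).comp z.2 differentiableAt_snd)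
  have u₀ := hs.differentiableAt_unitField hz.1
  have hcongr := divergence_congr (x := z)
    (g := inducedMetric euclidean (productLift δ s f₁ f₂))
    (g' := fun z u v => phaseMetric (Real.cos δ ^ 2 * Real.sin δ ^ 2) s z.1 u.1 v.1 +
      weightedMetric δ f₁ f₂ z.2 u.2 v.2)
    (X := fun z => sharp (inducedMetric euclidean (productLift δ s f₁ f₂) z)
      (meanForm (productLift δ s f₁ f₂) z))
    (X' := fun z => (c₀ • unitField s hs.finrank_eq z.1,
      (fun y : E₁ × E₂ => (c₁ • sphereJH f₁ y.1, c₂ • sphereJH f₂ y.2)) z.2))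
    (by filter_upwards [hU] with z' hz' using inducedMetric_productLift hs h₁ h₂ hz')
    (by filter_upwards [hU] with z' hz' using sharp_meanForm_productLift hδ hs h₁ h₂ hz')
  have hfst : ∀ᶠ t in 𝓝 z.1,
      IsScalarProduct (phaseMetric (Real.cos δ ^ 2 * Real.sin δ ^ 2) s t) := by
    filter_upwards [hs.isOpen.mem_nhds hz.1] with t ht
    exact hs.isScalarProduct ht (mul_pos hc hsn)
  have hsnd : ∀ᶠ y in 𝓝 z.2, IsScalarProduct (weightedMetric δ f₁ f₂ y) := by
    filter_upwards [(h₁.isOpen.prod h₂.isOpen).mem_nhds hz.2] with y hy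
    exact isScalarProduct_weightedMetric hδ h₁ h₂ hy
  rw [hcongr, divergence_prod (X₁ := fun t => c₀ • unitField s hs.finrank_eq t) hfst hsnd p₀ pW
      (u₀.const_smul c₀) dW,
    divergence_const_smul _ c₀ (p₀.smul u₀), hs.divergence_unitField hz.1 (mul_pos hc hsn), mul_zero,
    zero_add]
  have hprod := divergence_prod (x := z.2)
    (g₁ := fun x u v => Real.cos δ ^ 2 * inducedMetric euclidean f₁ x u v)
    (g₂ := fun x u v => Real.sin δ ^ 2 * inducedMetric euclidean f₂ x u v)
    (X₁ := fun x => c₁ • sphereJH f₁ x) (X₂ := fun x => c₂ • sphereJH f₂ x)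
    (by filter_upwards [h₁.mem_nhds hz.2.1] with x hx using (h₁.isScalarProduct hx).const_mul hc)
    (by filter_upwards [h₂.mem_nhds hz.2.2] with x hx using (h₂.isScalarProduct hx).const_mul hsn)
    (differentiableAt_sqrt_det_gram m₁ ((h₁.isScalarProduct hz.2.1).const_mul hc))
    (differentiableAt_sqrt_det_gram m₂ ((h₂.isScalarProduct hz.2.2).const_mul hsn))
    (j₁.const_smul c₁) (j₂.const_smul c₂)
  refine hprod.trans ?_
  rw [divergence_const_mul_metric (X := fun x => c₁ • sphereJH f₁ x) _ hc (r₁.smul (j₁.const_smul c₁)),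
    divergence_const_mul_metric (X := fun x => c₂ • sphereJH f₂ x) _ hsn (r₂.smul (j₂.const_smul c₂)),
    divergence_const_smul _ c₁ (r₁.smul j₁), divergence_const_smul _ c₂ (r₂.smul j₂)]

end ProductGeometry

/-! ### From manifolds to charts: local expressions and local angles. -/

section LocalLifts

theorem LegendrianOn.mono {E : Type*} [NormedAddCommGroup E] [NormedSpace ℝ E]
    [FiniteDimensional ℝ E] {m : ℕ} {f : E → CSpace m} {U V : Set E} (hf : LegendrianOn f U)
    (hV : IsOpen V) (h : V ⊆ U) : LegendrianOn f V where
  isOpen := hV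
  contDiffOn := hf.contDiffOn.mono h
  norm_eq_one x hx := hf.norm_eq_one x (h hx)
  injective x hx := hf.injective x (h hx)
  inner_fderiv x hx := hf.inner_fderiv x (h hx)

/-- In ⟨f, f_*v⟩ = 0 the real part comes from |f| = 1 and the imaginary part from the vanishing of
the Liouville form. -/
theorem legendrianOn_sphereLocal {E H M : Type*} [NormedAddCommGroup E] [NormedSpace ℝ E]
    [FiniteDimensional ℝ E] [TopologicalSpace H] {I : ModelWithCorners ℝ E H} [I.Boundaryless]
    [TopologicalSpace M] [ChartedSpace H M] [IsManifold I ∞ M] {n : ℕ} {φ : M → USphere n}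
    (h : IsLegendrianImmersion I φ) (p : M) :
    LegendrianOn (sphereLocal I φ p) (extChartAt I p).target := by
  have hsymm : ∀ x ∈ (extChartAt I p).target,
      ContMDiffAt 𝓘(ℝ, E) I ∞ (extChartAt I p).symm x := fun x hx =>
    (contMDiffOn_extChartAt_symm p).contMDiffAt ((isOpen_extChartAt_target p).mem_nhds hx)
  have hsmooth : ∀ x ∈ (extChartAt I p).target, ContDiffAt ℝ ∞ (sphereLocal I φ p) x := fun x hx =>
    contMDiffAt_iff_contDiffAt.1 (h.contMDiff.contMDiffAt.comp x (hsymm x hx))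
  have hderiv : ∀ x ∈ (extChartAt I p).target, fderiv ℝ (sphereLocal I φ p) x =
      (mfderiv I 𝓘(ℝ, CSpace (n + 1)) (fun p => (φ p : CSpace (n + 1))) ((extChartAt I p).symm x)).comp
        (mfderiv 𝓘(ℝ, E) I (extChartAt I p).symm x) := fun x hx => by
    rw [← mfderiv_eq_fderiv]
    exact mfderiv_comp x (h.contMDiff.contMDiffAt.mdifferentiableAt (by simp))
      ((hsymm x hx).mdifferentiableAt (by simp))
  have hnorm : ∀ x, ‖sphereLocal I φ p x‖ = 1 := fun x => norm_eq_of_mem_sphere _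
  refine ⟨isOpen_extChartAt_target p, fun x hx => (hsmooth x hx).contDiffWithinAt,
    fun x _ => hnorm x, fun x hx => ?_, fun x hx v => ?_⟩
  · rw [hderiv x hx]
    refine (h.injective_mfderiv _).comp ?_
    have hinv := isInvertible_mfderivWithin_extChartAt_symm (I := I) hx
    rw [I.range_eq_univ, mfderivWithin_univ] at hinv
    exact hinv.injective
  · have hd := (hsmooth x hx).differentiableAt (by simp)
    refine Complex.ext ?_ ?_
    · have h1 := fderiv_inner_apply ℂ hd hd v
      have h2 : (fun x => inner ℂ (sphereLocal I φ p x) (sphereLocal I φ p x)) = fun _ => (1 : ℂ) := by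
        funext x
        rw [inner_self_eq_norm_sq_to_K, hnorm]
        simp
      rw [h2, ← inner_conj_symm (fderiv ℝ (sphereLocal I φ p) x v)] at h1
      have h3 := congrArg Complex.re h1
      rw [Complex.add_re, Complex.conj_re, fderiv_fun_const, Pi.zero_apply, zero_apply] at h3
      rw [Complex.zero_re] at h3 ⊢
      linarith
    · have h1 := h.liouville_eq_zero ((extChartAt I p).symm x)
        (mfderiv 𝓘(ℝ, E) I (extChartAt I p).symm x v)
      have h2 : liouville (sphereLocal I φ p x) (fderiv ℝ (sphereLocal I φ p) x v) = 0 := by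
        rw [hderiv x hx]
        exact h1
      rw [liouville, inner_smul_right, Complex.I_mul_re, neg_eq_zero] at h2
      rw [← inner_conj_symm, Complex.conj_im, h2, neg_zero, Complex.zero_im]

/-- A local branch of the angle in the chart at `z₀`. That it is an angle holds at every `t`; only
smoothness requires restriction to `U`. -/
theorem exists_phase (z₀ : Circle) : ∃ (s : EuclideanSpace ℝ (Fin 1) → ℝ)
    (U : Set (EuclideanSpace ℝ (Fin 1))), IsPhaseOn s U ∧ extChartAt (𝓡 1) z₀ z₀ ∈ U ∧
      ∀ t, Circle.exp (s t) = (extChartAt (𝓡 1) z₀).symm t := by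
  set χ := extChartAt (𝓡 1) z₀ with hχ
  have hfin : Fact (finrank ℝ ℂ = 1 + 1) := ⟨Complex.finrank_real_complex⟩
  have hman : IsManifold (𝓡 1) ∞ Circle := .of_le (n := ω) (by simp)
  -- Division by `z₀` moves the base point to 1, away from the cut of `Complex.arg`.
  let s : EuclideanSpace ℝ (Fin 1) → ℝ := fun t => Complex.arg z₀ + Complex.arg (χ.symm t / z₀ : Circle)
  have hexp : ∀ t, Circle.exp (s t) = χ.symm t := fun t => by
    rw [Circle.exp_add, Circle.exp_arg, Circle.exp_arg, mul_div_cancel]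
  have hopen : IsOpen χ.target := isOpen_extChartAt_target z₀
  let U := χ.target ∩ χ.symm ⁻¹' {z | ((z / z₀ : Circle) : ℂ) ∈ Complex.slitPlane}
  have hU : IsOpen U := (continuousOn_extChartAt_symm z₀).isOpen_inter_preimage hopen
    (Complex.isOpen_slitPlane.preimage (by fun_prop))
  have hsymm : ∀ t ∈ χ.target, ContMDiffAt 𝓘(ℝ, EuclideanSpace ℝ (Fin 1)) (𝓡 1) ∞ χ.symm t :=
    fun t ht => (contMDiffOn_extChartAt_symm z₀).contMDiffAt (hopen.mem_nhds ht)
  have hcoe : ContMDiff (𝓡 1) 𝓘(ℝ, ℂ) ∞ (fun z : Circle => (z : ℂ)) :=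
    contMDiff_coe_sphere (E := ℂ) (n := 1)
  have hs : ∀ t ∈ U, ContDiffAt ℝ ∞ s t := fun t ht => by
    have h1 : ContDiffAt ℝ ∞ (fun t => ((χ.symm t : Circle) : ℂ)) t :=
      contMDiffAt_iff_contDiffAt.1 (hcoe.contMDiffAt.comp t (hsymm t ht.1))
    have h2 : ContDiffAt ℝ ∞ (fun t => ((χ.symm t / z₀ : Circle) : ℂ)) t := by
      simp only [div_eq_mul_inv]
      exact h1.mul contDiffAt_const
    have h3 := ((Complex.contDiffAt_log (n := ∞) ht.2).restrict_scalars ℝ).comp t h2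
    have h4 := (Complex.imCLM.contDiff.contDiffAt (n := ∞)).comp t h3
    have h5 : (Complex.imCLM ∘ Complex.log ∘ fun t => ((χ.symm t / z₀ : Circle) : ℂ)) =
        fun t => Complex.arg (χ.symm t / z₀ : Circle) := funext fun _ => Complex.log_im _
    rw [h5] at h4
    exact contDiffAt_const.add h4
  refine ⟨s, U, ⟨finrank_euclideanSpace_fin, hU, fun t ht => (hs t ht).contDiffWithinAt,
    fun t ht h0 => ?_⟩, ⟨mem_extChartAt_target z₀, ?_⟩, hexp⟩
  -- Near `t` the composite χ ∘ exp ∘ s is the identity, so ds = 0 would make the identity of the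
  -- line zero.
  · have h1 : ContMDiffAt (𝓡 1) 𝓘(ℝ, EuclideanSpace ℝ (Fin 1)) ∞ χ (Circle.exp (s t)) := by
      refine contMDiffAt_extChartAt' ?_
      rw [hexp, ← extChartAt_source (𝓡 1)]
      exact χ.map_target ht.1
    have h2 : ContDiffAt ℝ ∞ (fun r => χ (Circle.exp r)) (s t) :=
      contMDiffAt_iff_contDiffAt.1 (h1.comp (s t) contMDiff_circleExp.contMDiffAt)
    have h3 := (h2.differentiableAt (by simp)).hasFDerivAt.comp t
      ((hs t ht).differentiableAt (by simp)).hasFDerivAt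
    have h4 : ((fun r => χ (Circle.exp r)) ∘ s) =ᶠ[𝓝 t] id := by
      filter_upwards [hopen.mem_nhds ht.1] with t' ht'
      simp only [Function.comp_apply, hexp, id]
      exact χ.right_inv ht'
    have h5 := (h3.congr_of_eventuallyEq h4.symm).unique (hasFDerivAt_id t)
    rw [h0, ContinuousLinearMap.comp_zero] at h5
    have h6 := congrArg (fun L : EuclideanSpace ℝ (Fin 1) →L[ℝ] EuclideanSpace ℝ (Fin 1) =>
      L (EuclideanSpace.single 0 1) 0) h5
    simp at h6
  · have : χ.symm (χ z₀) = z₀ := extChartAt_to_inv z₀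
    simp [this]

end LocalLifts

/-! ### The global map and the conclusions. -/

section TorusMap

variable {n₁ n₂ : ℕ} {N₁ N₂ : Type*}

theorem join_circle_ne_zero (δ : ℝ) (w : Circle) (x : USphere n₁) (y : USphere n₂) :
    join ((Real.cos δ * (w : ℂ)) • (x : CSpace (n₁ + 1)), (Real.sin δ : ℂ) • (y : CSpace (n₂ + 1)))
      ≠ 0 := fun h => by
  have h1 := norm_pairVec_sq (Real.cos δ * (w : ℂ)) (Real.sin δ : ℂ) (x : CSpace (n₁ + 1))
    (y : CSpace (n₂ + 1))
  rw [pairVec_eq_join, h, norm_eq_of_mem_sphere x, norm_eq_of_mem_sphere y] at h1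
  have h2 := Real.cos_sq_add_sin_sq δ
  simp only [norm_zero, norm_mul, Circle.norm_coe, Complex.norm_real, Real.norm_eq_abs, mul_one,
    sq_abs] at h1
  linarith

/-- The map `(w, p, q) ↦ [(cos δ w ψ₁(p), sin δ ψ₂(q))]`. -/
def torusMap (δ : ℝ) (ψ₁ : N₁ → USphere n₁) (ψ₂ : N₂ → USphere n₂) (w : Circle × N₁ × N₂) :
    CP (n₁ + n₂ + 1) :=
  CP.mk ⟨join ((Real.cos δ * (w.1 : ℂ)) • (ψ₁ w.2.1 : CSpace (n₁ + 1)),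
    (Real.sin δ : ℂ) • (ψ₂ w.2.2 : CSpace (n₂ + 1))), join_circle_ne_zero δ _ _ _⟩

theorem liftPoint_eq_join (δ s : ℝ) (x : USphere n₁) (y : USphere n₂) :
    (liftPoint δ s x y : CSpace (n₁ + n₂ + 1 + 1)) =
      join (twist (Real.cos δ) (Real.sin δ ^ 2) s • (x : CSpace (n₁ + 1)),
        twist (Real.sin δ) (-Real.cos δ ^ 2) s • (y : CSpace (n₂ + 1))) := by
  rw [← pairVec_eq_join]
  change pairVec _ _ _ _ = _
  congr 1
  · rw [twist]
    push_cast
    ring_nf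
  · rw [twist]
    push_cast
    ring_nf

theorem torusMap_exp (δ : ℝ) (ψ₁ : N₁ → USphere n₁) (ψ₂ : N₂ → USphere n₂) (s : ℝ) (p : N₁) (q : N₂) :
    torusMap δ ψ₁ ψ₂ (Circle.exp s, p, q) = CP.hopf (liftPoint δ s (ψ₁ p) (ψ₂ q)) := by
  rw [torusMap, CP.hopf, CP.mk_eq_mk_iff]
  -- This scalar turns the phases s sin²δ and -s cos²δ into s and 0.
  refine ⟨Complex.exp (Complex.I * (Real.cos δ ^ 2 * s : ℝ)), ?_⟩
  change _ • (liftPoint δ s (ψ₁ p) (ψ₂ q) : CSpace (n₁ + n₂ + 1 + 1)) = _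
  rw [liftPoint_eq_join, ← map_smul, Prod.smul_mk, smul_smul, smul_smul]
  have h := Real.sin_sq_add_cos_sq δ
  congr 3
  · rw [twist, mul_left_comm, ← Complex.exp_add, ← mul_add, ← Complex.ofReal_add, ← add_mul,
      add_comm (Real.cos δ ^ 2), h, one_mul, Circle.coe_exp, mul_comm Complex.I]
  · rw [twist, mul_left_comm, ← Complex.exp_add, ← mul_add, ← Complex.ofReal_add, ← add_mul,
      add_neg_cancel, zero_mul, Complex.ofReal_zero, mul_zero, Complex.exp_zero, mul_one]

variable [TopologicalSpace N₁] [ChartedSpace (EuclideanSpace ℝ (Fin n₁)) N₁]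
  [TopologicalSpace N₂] [ChartedSpace (EuclideanSpace ℝ (Fin n₂)) N₂]

/-- The model of `S¹ × N₁ × N₂`. -/
abbrev torusModel (n₁ n₂ : ℕ) := (𝓡 1).prod ((𝓡 n₁).prod (𝓡 n₂))

theorem finrank_torusModel : finrank ℝ
    (EuclideanSpace ℝ (Fin 1) × EuclideanSpace ℝ (Fin n₁) × EuclideanSpace ℝ (Fin n₂)) =
      n₁ + n₂ + 1 := by
  simp only [finrank_prod, finrank_euclideanSpace_fin]
  omega

theorem continuous_torusMap (δ : ℝ) {ψ₁ : N₁ → USphere n₁} {ψ₂ : N₂ → USphere n₂}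
    (h₁ : Continuous ψ₁) (h₂ : Continuous ψ₂) : Continuous (torusMap δ ψ₁ ψ₂) := by
  refine CP.isQuotientMap_mk.continuous.comp (Continuous.subtype_mk (joinCLM.continuous.comp ?_) _)
  fun_prop

/-- The local expression is an equality of functions on the whole model space: the angle is valid at
every `t`, and `affineCoord` is the same quotient formula also outside its chart domain. -/
theorem exists_projLocal_torusMap_eq (δ : ℝ) (ψ₁ : N₁ → USphere n₁) (ψ₂ : N₂ → USphere n₂)
    (w : Circle × N₁ × N₂) :
    ∃ (s : EuclideanSpace ℝ (Fin 1) → ℝ) (U : Set (EuclideanSpace ℝ (Fin 1)))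
      (i : Fin (n₁ + n₂ + 1 + 1)), IsPhaseOn s U ∧
      extChartAt (torusModel n₁ n₂) w w ∈
        U ×ˢ (extChartAt (𝓡 n₁) w.2.1).target ×ˢ (extChartAt (𝓡 n₂) w.2.2).target ∧
      productLift δ s (sphereLocal (𝓡 n₁) ψ₁ w.2.1) (sphereLocal (𝓡 n₂) ψ₂ w.2.2)
        (extChartAt (torusModel n₁ n₂) w w) i ≠ 0 ∧
      projLocal (torusModel n₁ n₂) (torusMap δ ψ₁ ψ₂) w = fun z => affineProj i
        (productLift δ s (sphereLocal (𝓡 n₁) ψ₁ w.2.1) (sphereLocal (𝓡 n₂) ψ₂ w.2.2) z) := by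
  obtain ⟨z₀, p, q⟩ := w
  obtain ⟨s, U, hs, hmem, hexp⟩ := exists_phase z₀
  -- The index must be the one selected by `chartAt`, so that the charts agree definitionally.
  set i := (CP.exists_mem_affineDomain (torusMap δ ψ₁ ψ₂ (z₀, p, q))).choose with hi
  have hi' : torusMap δ ψ₁ ψ₂ (z₀, p, q) ∈ CP.affineDomain i :=
    (CP.exists_mem_affineDomain (torusMap δ ψ₁ ψ₂ (z₀, p, q))).choose_spec
  have hval : ∀ z, torusMap δ ψ₁ ψ₂ ((extChartAt (torusModel n₁ n₂) (z₀, p, q)).symm z) =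
      CP.hopf (liftPoint δ (s z.1) (ψ₁ ((extChartAt (𝓡 n₁) p).symm z.2.1))
        (ψ₂ ((extChartAt (𝓡 n₂) q).symm z.2.2))) := fun z => by
    rw [← torusMap_exp, hexp, extChartAt_prod, extChartAt_prod]
    rfl
  have hlift : ∀ z, (liftPoint δ (s z.1) (ψ₁ ((extChartAt (𝓡 n₁) p).symm z.2.1))
      (ψ₂ ((extChartAt (𝓡 n₂) q).symm z.2.2)) : CSpace (n₁ + n₂ + 1 + 1)) =
      productLift δ s (sphereLocal (𝓡 n₁) ψ₁ p) (sphereLocal (𝓡 n₂) ψ₂ q) z :=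
    fun z => liftPoint_eq_join _ _ _ _
  refine ⟨s, U, i, hs, ?_, ?_, ?_⟩
  · rw [extChartAt_prod, extChartAt_prod]
    exact ⟨hmem, mem_extChartAt_target p, mem_extChartAt_target q⟩
  · rw [← hlift]
    have h := hval (extChartAt (torusModel n₁ n₂) (z₀, p, q) (z₀, p, q))
    rw [extChartAt_to_inv] at h
    rw [h, CP.hopf, CP.mk_mem_affineDomain] at hi'
    exact hi'
  · funext z
    change CP.affineCoord i _ = _
    rw [hval, CP.hopf, CP.affineCoord_mk, ← hlift]
    rfl

variable [IsManifold (𝓡 n₁) ∞ N₁] [IsManifold (𝓡 n₂) ∞ N₂]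
  {ψ₁ : N₁ → USphere n₁} {ψ₂ : N₂ → USphere n₂} (h₁ : IsLegendrianImmersion (𝓡 n₁) ψ₁)
  (h₂ : IsLegendrianImmersion (𝓡 n₂) ψ₂) {δ : ℝ} (hδ : δ ∈ Ioo 0 (Real.pi / 2))
include h₁ h₂ hδ

/-- Near each point, `torusMap` is the projection of a Legendrian immersion in product form. -/
theorem exists_local_lift (w : Circle × N₁ × N₂) :
    ∃ (s : EuclideanSpace ℝ (Fin 1) → ℝ) (U : Set (EuclideanSpace ℝ (Fin 1)))
      (i : Fin (n₁ + n₂ + 1 + 1))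
      (V : Set (EuclideanSpace ℝ (Fin 1) × EuclideanSpace ℝ (Fin n₁) × EuclideanSpace ℝ (Fin n₂))),
      IsPhaseOn s U ∧
      V ⊆ U ×ˢ (extChartAt (𝓡 n₁) w.2.1).target ×ˢ (extChartAt (𝓡 n₂) w.2.2).target ∧
      extChartAt (torusModel n₁ n₂) w w ∈ V ∧
      LegendrianOn (productLift δ s (sphereLocal (𝓡 n₁) ψ₁ w.2.1) (sphereLocal (𝓡 n₂) ψ₂ w.2.2)) V ∧
      (∀ z ∈ V, productLift δ s (sphereLocal (𝓡 n₁) ψ₁ w.2.1) (sphereLocal (𝓡 n₂) ψ₂ w.2.2) z i ≠ 0) ∧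
      projLocal (torusModel n₁ n₂) (torusMap δ ψ₁ ψ₂) w = fun z => affineProj i
        (productLift δ s (sphereLocal (𝓡 n₁) ψ₁ w.2.1) (sphereLocal (𝓡 n₂) ψ₂ w.2.2) z) := by
  obtain ⟨s, U, i, hs, hmem, hi, hproj⟩ := exists_projLocal_torusMap_eq δ ψ₁ ψ₂ w
  have hF := legendrianOn_productLift hδ hs (legendrianOn_sphereLocal h₁ w.2.1)
    (legendrianOn_sphereLocal h₂ w.2.2)
  have hcoord : ContinuousOn (fun z => productLift δ s (sphereLocal (𝓡 n₁) ψ₁ w.2.1)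
      (sphereLocal (𝓡 n₂) ψ₂ w.2.2) z i) _ := fun z hz =>
    (differentiableAt_coord (hF.differentiableAt hz) i).continuousAt.continuousWithinAt
  exact ⟨s, U, i, _, hs, inter_subset_left, ⟨hmem, hi⟩, hF.mono
    (hcoord.isOpen_inter_preimage hF.isOpen isOpen_ne) inter_subset_left, fun z hz => hz.2, hproj⟩

theorem contMDiff_torusMap :
    ContMDiff (torusModel n₁ n₂) 𝓘(ℝ, CSpace (n₁ + n₂ + 1)) ∞ (torusMap δ ψ₁ ψ₂) := fun w => by
  obtain ⟨s, U, i, V, hs, hV, hmem, hF, hi, hproj⟩ := exists_local_lift h₁ h₂ hδ w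
  refine contMDiffAt_iff.2 ⟨(continuous_torusMap δ ?_ ?_).continuousAt, ?_⟩
  · exact h₁.contMDiff.continuous.subtype_mk fun p => (ψ₁ p).2
  · exact h₂.contMDiff.continuous.subtype_mk fun p => (ψ₂ p).2
  · have h := hF.contDiffAt_proj hi hmem
    rw [← hproj] at h
    exact h.contDiffWithinAt

theorem mfderiv_torusMap (w : Circle × N₁ × N₂) :
    mfderiv (torusModel n₁ n₂) 𝓘(ℝ, CSpace (n₁ + n₂ + 1)) (torusMap δ ψ₁ ψ₂) w =
      fderiv ℝ (projLocal (torusModel n₁ n₂) (torusMap δ ψ₁ ψ₂) w)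
        (extChartAt (torusModel n₁ n₂) w w) := by
  refine ((contMDiff_torusMap h₁ h₂ hδ).contMDiffAt.mdifferentiableAt (by simp)).mfderiv.trans ?_
  rw [ModelWithCorners.range_eq_univ, fderivWithin_univ]
  rfl

theorem isLagrangianImmersion_torusMap :
    IsLagrangianImmersion (torusModel n₁ n₂) (torusMap δ ψ₁ ψ₂) where
  finrank_eq := finrank_torusModel
  contMDiff := contMDiff_torusMap h₁ h₂ hδ
  injective_mfderiv w := by
    obtain ⟨s, U, i, V, hs, hV, hmem, hF, hi, hproj⟩ := exists_local_lift h₁ h₂ hδ w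
    rw [mfderiv_torusMap h₁ h₂ hδ, hproj]
    exact hF.injective_fderiv_proj hi hmem
  form_eq_zero w u v := by
    obtain ⟨s, U, i, V, hs, hV, hmem, hF, hi, hproj⟩ := exists_local_lift h₁ h₂ hδ w
    have h0 : chartAt (CSpace (n₁ + n₂ + 1)) (torusMap δ ψ₁ ψ₂ w) (torusMap δ ψ₁ ψ₂ w) =
        projLocal (torusModel n₁ n₂) (torusMap δ ψ₁ ψ₂) w (extChartAt (torusModel n₁ n₂) w w) := by
      rw [projLocal, extChartAt_to_inv]
    rw [mfderiv_torusMap h₁ h₂ hδ, h0, hproj]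
    exact hF.fubiniStudyForm_fderiv_proj hi hmem u v

theorem isHMinimal_torusMap (hC₁ : IsCMinimal (𝓡 n₁) ψ₁) (hC₂ : IsCMinimal (𝓡 n₂) ψ₂) :
    IsHMinimal (torusModel n₁ n₂) (torusMap δ ψ₁ ψ₂) := fun w => by
  obtain ⟨s, U, i, V, hs, hV, hmem, hF, hi, hproj⟩ := exists_local_lift h₁ h₂ hδ w
  have hd := divergence_productLift hδ hs (legendrianOn_sphereLocal h₁ w.2.1)
    (legendrianOn_sphereLocal h₂ w.2.2) (hV hmem)
  -- The chart of the product at `w` is the product of the charts at its components, so C-minimality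
  -- is used exactly at their centres.
  have e₁ : (extChartAt (torusModel n₁ n₂) w w).2.1 = extChartAt (𝓡 n₁) w.2.1 w.2.1 := rfl
  have e₂ : (extChartAt (torusModel n₁ n₂) w w).2.2 = extChartAt (𝓡 n₂) w.2.2 w.2.2 := rfl
  rw [e₁, e₂, hC₁ w.2.1, hC₂ w.2.2, mul_zero, mul_zero, add_zero] at hd
  rw [hproj, ← hd]
  refine divergence_congr ?_ ?_
  · filter_upwards [hF.mem_nhds hmem] with z hz using hF.inducedMetric_fubiniStudy hi hz
  · filter_upwards [hF.mem_nhds hmem] with z hz using hF.projJH_eq_sharp hi hz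

theorem meanCurvature_torusMap_eq_zero_iff (w : Circle × N₁ × N₂) :
    meanCurvature fubiniStudy (projLocal (torusModel n₁ n₂) (torusMap δ ψ₁ ψ₂) w)
        (extChartAt (torusModel n₁ n₂) w w) = 0 ↔
      Real.cos δ ^ 2 * ((n₂ : ℝ) + 1) = Real.sin δ ^ 2 * ((n₁ : ℝ) + 1) ∧
        sphereMeanCurvature (sphereLocal (𝓡 n₁) ψ₁ w.2.1) (extChartAt (𝓡 n₁) w.2.1 w.2.1) = 0 ∧
        sphereMeanCurvature (sphereLocal (𝓡 n₂) ψ₂ w.2.2) (extChartAt (𝓡 n₂) w.2.2 w.2.2) = 0 := by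
  obtain ⟨s, U, i, V, hs, hV, hmem, hF, hi, hproj⟩ := exists_local_lift h₁ h₂ hδ w
  have l₁ := legendrianOn_sphereLocal h₁ w.2.1
  have l₂ := legendrianOn_sphereLocal h₂ w.2.2
  rw [hproj, hF.meanCurvature_fubiniStudy_eq_zero_iff hi hmem (finrank_torusModel),
    meanForm_productLift_eq_zero_iff hδ hs l₁ l₂ (hV hmem),
    l₁.sphereMeanCurvature_eq_zero_iff (mem_extChartAt_target _) h₁.finrank_eq,
    l₂.sphereMeanCurvature_eq_zero_iff (mem_extChartAt_target _) h₂.finrank_eq,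
    h₁.finrank_eq, h₂.finrank_eq]
  rfl

theorem isMinimalInCP_torusMap_iff [Nonempty N₁] [Nonempty N₂] :
    IsMinimalInCP (torusModel n₁ n₂) (torusMap δ ψ₁ ψ₂) ↔
      IsMinimalInSphere (𝓡 n₁) ψ₁ ∧ IsMinimalInSphere (𝓡 n₂) ψ₂ ∧
        Real.tan δ ^ 2 = ((n₂ : ℝ) + 1) / ((n₁ : ℝ) + 1) := by
  have htan : Real.tan δ ^ 2 = ((n₂ : ℝ) + 1) / ((n₁ : ℝ) + 1) ↔
      Real.cos δ ^ 2 * ((n₂ : ℝ) + 1) = Real.sin δ ^ 2 * ((n₁ : ℝ) + 1) := by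
    rw [Real.tan_eq_sin_div_cos, div_pow, div_eq_div_iff (cos_sq_pos hδ).ne' (by positivity), eq_comm,
      mul_comm ((n₂ : ℝ) + 1)]
  rw [htan]
  constructor
  · intro h
    -- Minimality of one factor at a point is read off on a slice, which needs some point of the
    -- other factor; the condition on δ needs a point of both.
    obtain ⟨p₀⟩ := ‹Nonempty N₁›
    obtain ⟨q₀⟩ := ‹Nonempty N₂›
    have h' := fun p q => (meanCurvature_torusMap_eq_zero_iff h₁ h₂ hδ (1, p, q)).1 (h (1, p, q))
    exact ⟨fun p => (h' p q₀).2.1, fun q => (h' p₀ q).2.2, (h' p₀ q₀).1⟩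
  · rintro ⟨k₁, k₂, k₃⟩ w
    exact (meanCurvature_torusMap_eq_zero_iff h₁ h₂ hδ w).2 ⟨k₃, k₁ w.2.1, k₂ w.2.2⟩

end TorusMap

end LagrangianCP

end

theorem corollary3 {n₁ n₂ : ℕ}
    {N₁ : Type*} [TopologicalSpace N₁] [ChartedSpace (EuclideanSpace ℝ (Fin n₁)) N₁]
    [IsManifold (𝓡 n₁) ∞ N₁] [Nonempty N₁]
    {N₂ : Type*} [TopologicalSpace N₂] [ChartedSpace (EuclideanSpace ℝ (Fin n₂)) N₂]
    [IsManifold (𝓡 n₂) ∞ N₂] [Nonempty N₂]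
    (ψ₁ : N₁ → LagrangianCP.USphere n₁) (ψ₂ : N₂ → LagrangianCP.USphere n₂)
    (hψ₁ : LagrangianCP.IsLegendrianImmersion (𝓡 n₁) ψ₁)
    (hψ₂ : LagrangianCP.IsLegendrianImmersion (𝓡 n₂) ψ₂)
    (hC₁ : LagrangianCP.IsCMinimal (𝓡 n₁) ψ₁) (hC₂ : LagrangianCP.IsCMinimal (𝓡 n₂) ψ₂)
    (δ : ℝ) (hδ : δ ∈ Set.Ioo 0 (Real.pi / 2)) :
    ∃ Φ : Circle × N₁ × N₂ → LagrangianCP.CP (n₁ + n₂ + 1),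
      (∀ (s : ℝ) (p : N₁) (q : N₂),
        Φ (Circle.exp s, p, q) = LagrangianCP.CP.hopf (LagrangianCP.liftPoint δ s (ψ₁ p) (ψ₂ q))) ∧
      LagrangianCP.IsLagrangianImmersion ((𝓡 1).prod ((𝓡 n₁).prod (𝓡 n₂))) Φ ∧
      LagrangianCP.IsHMinimal ((𝓡 1).prod ((𝓡 n₁).prod (𝓡 n₂))) Φ ∧
      (LagrangianCP.IsMinimalInCP ((𝓡 1).prod ((𝓡 n₁).prod (𝓡 n₂))) Φ ↔
        LagrangianCP.IsMinimalInSphere (𝓡 n₁) ψ₁ ∧ LagrangianCP.IsMinimalInSphere (𝓡 n₂) ψ₂ ∧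
          Real.tan δ ^ 2 = ((n₂ : ℝ) + 1) / ((n₁ : ℝ) + 1)) :=
  ⟨LagrangianCP.torusMap δ ψ₁ ψ₂, LagrangianCP.torusMap_exp δ ψ₁ ψ₂,
    LagrangianCP.isLagrangianImmersion_torusMap hψ₁ hψ₂ hδ,
    LagrangianCP.isHMinimal_torusMap hψ₁ hψ₂ hδ hC₁ hC₂,
    LagrangianCP.isMinimalInCP_torusMap_iff hψ₁ hψ₂ hδ⟩
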